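/- Let $\mathcal B\subset\mathbb R^2$ be a connected open set (possibly with holes) that is the interior of the union of the triangles of a finite conforming simplicial mesh with $N_v$ vertices and $N_{el}$ elements, and let $\Gamma_1\subset\partial\mathcal B$ be a (possibly empty) union of boundary edges of the mesh. Let $[V_h^1]^2\subset[H^1(\mathcal B)]^2$, $V_h^{\mathbf c}\subset H^{\mathbf c}(\mathcal B)$, $V_h^{\mathbf d}\subset H^{\mathbf d}(\mathcal B)$, $V_h^{\mathrm D}\subset L^2(\mathcal B)$ be finite-dimensional (finite element) spaces, where $H^{\mathbf c}$ and $H^{\mathbf d}$ are the spaces of $L^2$ tensor fields ($2\times2$ matrix fields) whose row-wise curl, respectively divergence, is in $L^2$. Let $[V^1_{h,1}]^2$ be the subspace of the fields of $[V^1_h]^2$ that vanish on $\Gamma_1$, let $Z_h=[V^1_{h,1}]^2\times V_h^{\mathbf c}\times V_h^{\mathbf d}\times V_h^{\mathrm D}$, and let $n_1,n_{\mathbf c},n_{\mathbf d},n_{\mathrm D}$ be the dimensions of its four factors. Write $\mathrm{D}k$ for the discontinuous piecewise polynomials of degree at most $k$, $\mathrm{L}k$ for the vector fields whose components are continuous Lagrange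 functions of degree $k$, $\mathrm{N11}$ for the tensor fields whose rows are lowest-order Nédélec fields of the first kind, and $\mathrm{R1}$ for those whose rows are lowest-order Raviart–Thomas fields, all on the given mesh. Suppose that the four spaces match one of the following patterns, where $\mathrm{FE}$ stands for an arbitrary choice: 1. $(\mathrm{L2},\mathrm{FE}_{\mathbf c},\mathrm{R1},\mathrm{FE}_{\mathrm D})$, and the number of vertices on $\Gamma_1$ plus the number of edges in $\Gamma_1$ is less than $N_v$ (which always holds if $\Gamma_1=\emptyset$); 2. $(\mathrm{FE}_1,\mathrm{N11},\mathrm{FE}_{\mathbf d},\mathrm{D2})$, and $N_{el}\ge2$; 3. $(\mathrm{L1},\mathrm{FE}_{\mathbf c},\mathrm{FE}_{\mathbf d},\mathrm{D1})$, and $\Gamma_1\ne\emptyset$ or $N_{el}\ge5$; 4. $(\mathrm{L1},\mathrm{FE}_{\mathbf c},\mathrm{FE}_{\mathbf d},\mathrm{D2})$, and $\Gamma_1\neq\emptyset$ or $N_{el}\ge2$. Then at least one of the inequalities (i) $n_1>n_{\mathbf d}$, (ii) $n_{\mathrm D}>n_{\mathbf c}$, (iii) $n_1>n_{\mathbf c}+n_{\mathrm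 D}$, (iv) $n_{\mathrm D}>n_1$ holds, and the method is unstable in the following sense. For $z=(\boldsymbol V,\boldsymbol M,\boldsymbol Q,r)$, $y=(\boldsymbol\Upsilon,\boldsymbol\lambda,\boldsymbol\pi,q)$ and a state $u=(\boldsymbol U,\boldsymbol K,\boldsymbol P,p)\in [H^1]^2\times H^{\mathbf c}\times H^{\mathbf d}\times L^2$ put $$\begin{aligned} b(z,y;u)=\;&\langle\boldsymbol Q,\mathrm{grad}\,\boldsymbol\Upsilon\rangle+\langle\mathrm{grad}\,\boldsymbol V,\boldsymbol\lambda\rangle-\langle\boldsymbol M,\boldsymbol\lambda\rangle+\langle\mathsf A(\boldsymbol K){:}\boldsymbol M,\boldsymbol\pi\rangle-\langle\boldsymbol Q,\boldsymbol\pi\rangle\\&+\langle p(\boldsymbol I+\boldsymbol K)^{-T}\boldsymbol M^T(\boldsymbol I+\boldsymbol K)^{-T},\boldsymbol\pi\rangle-\langle r(\boldsymbol I+\boldsymbol K)^{-T},\boldsymbol\pi\rangle+\langle\det(\boldsymbol I+\boldsymbol K)\,\mathrm{tr}[(\boldsymbol I+\boldsymbol K)^{-1}\boldsymbol M],q\rangle,\end{aligned}$$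 with $L^2(\mathcal B)$ inner products and any elasticity tensor $\mathsf A(\boldsymbol K)$. For every $u$ for which $b(\cdot,\cdot;u)$ is well defined on $Z_h$ ($\boldsymbol I+\boldsymbol K$ invertible almost everywhere and all integrands integrable), there is no $\alpha>0$ with $$\inf_{0\ne y\in Z_h}\ \sup_{0\ne z\in Z_h}\frac{b(z,y;u)}{\|z\|_Z\|y\|_Z}\ge\alpha,$$ where $\|\cdot\|_Z$ is the Hilbert norm of $[H^1]^2\times H^{\mathbf c}\times H^{\mathbf d}\times L^2$; and for every right-hand side $\ell$ the linear problem of Newton's iteration, to find $z\in Z_h$ with $b(z,y;u)=\ell(y)$ for all $y\in Z_h$, does not have a unique solution. -/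

import Mathlib

open MeasureTheory
open scoped ENNReal ContDiff

noncomputable section

/-- Points of the plane. -/
abbrev Pt : Type := EuclideanSpace ℝ (Fin 2)

/-- The Cartesian components of a second-order tensor in the plane. -/
abbrev Mat2 : Type := Matrix (Fin 2) (Fin 2) ℝ

/-- A conforming simplicial mesh of a planar domain: finitely many nondegenerate triangles, given by
their vertex sets, any two of which meet exactly in the convex hull of their common vertices.  The
meshed domain, which is the interior of the union of the closed triangles, is connected; it may
have any number of holes. -/
structure TriMesh where
  cells : Finset (Finset Pt)
  card_eq : ∀ K ∈ cells, K.card = 3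
  indep : ∀ K ∈ cells, AffineIndependent ℝ ((↑) : K → Pt)
  conform : ∀ K ∈ cells, ∀ K' ∈ cells,
    convexHull ℝ (K : Set Pt) ∩ convexHull ℝ (K' : Set Pt) =
      convexHull ℝ ((K : Set Pt) ∩ (K' : Set Pt))
  connected : IsConnected (interior (⋃ K ∈ cells, convexHull ℝ (K : Set Pt)))

namespace TriMesh

/-- The reference configuration: the open set that is meshed. -/
def body (T : TriMesh) : Set Pt := interior (⋃ K ∈ T.cells, convexHull ℝ (K : Set Pt))

/-- The vertices of the mesh. -/
def vertices (T : TriMesh) : Set Pt := {a | ∃ K ∈ T.cells, a ∈ K}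

/-- The edges of the mesh, as two-point sets. -/
def edges (T : TriMesh) : Set (Finset Pt) := {e | e.card = 2 ∧ ∃ K ∈ T.cells, e ⊆ K}

/-- The boundary edges: those that belong to exactly one element. -/
def boundaryEdges (T : TriMesh) : Set (Finset Pt) :=
  {e | e ∈ T.edges ∧ ∃! K, K ∈ T.cells ∧ e ⊆ K}

end TriMesh

/-- The part of the plane covered by a set of edges. -/
def edgeUnion (Γ : Finset (Finset Pt)) : Set Pt := ⋃ e ∈ Γ, convexHull ℝ (e : Set Pt)

/-- The end points of a set of edges. -/
def edgeVertices (Γ : Finset (Finset Pt)) : Set Pt := {a | ∃ e ∈ Γ, a ∈ e}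

/-- Lebesgue measure on the body. -/
def bodyMeasure (T : TriMesh) : Measure Pt := volume.restrict T.body

/-- Scalar `L²` functions on the body. -/
abbrev LTwo (T : TriMesh) : Type := Lp ℝ 2 (bodyMeasure T)

/-- `L²` vector fields, by components. -/
abbrev VecField (T : TriMesh) : Type := Fin 2 → LTwo T

/-- `L²` second-order tensor fields, by components. -/
abbrev TenField (T : TriMesh) : Type := Fin 2 → Fin 2 → LTwo T

/-- The partial derivative of a function on the plane. -/
def partialD (j : Fin 2) (φ : Pt → ℝ) (x : Pt) : ℝ := fderiv ℝ φ x (EuclideanSpace.single j 1)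

/-- Smooth functions of compact support on the plane whose support lies in `s`. -/
structure IsTest (s : Set Pt) (φ : Pt → ℝ) : Prop where
  smooth : ContDiff ℝ ∞ φ
  compact : HasCompactSupport φ
  supp : tsupport φ ⊆ s

/-- The integral over the body of an `L²` function times a function. -/
def pairing (T : TriMesh) (f : LTwo T) (ψ : Pt → ℝ) : ℝ := ∫ x, f x * ψ x ∂(bodyMeasure T)

theorem IsTest.memLp {s : Set Pt} {φ : Pt → ℝ} (h : IsTest s φ) (T : TriMesh) :
    MemLp φ 2 (bodyMeasure T) :=
  (h.smooth.continuous.memLp_of_hasCompactSupport h.compact).restrict _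

theorem IsTest.memLp_partialD {s : Set Pt} {φ : Pt → ℝ} (h : IsTest s φ) (T : TriMesh)
    (j : Fin 2) : MemLp (partialD j φ) 2 (bodyMeasure T) := by
  have hc : Continuous (partialD j φ) :=
    (h.smooth.continuous_fderiv (by simp)).clm_apply continuous_const
  have hs : HasCompactSupport (partialD j φ) := h.compact.fderiv_apply (𝕜 := ℝ) _
  exact (hc.memLp_of_hasCompactSupport hs).restrict _

theorem pairing_zero (T : TriMesh) (ψ : Pt → ℝ) : pairing T 0 ψ = 0 := by
  unfold pairing
  rw [integral_eq_zero_of_ae]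
  filter_upwards [Lp.coeFn_zero ℝ 2 (bodyMeasure T)] with x hx
  rw [hx]
  simp

theorem pairing_add (T : TriMesh) (f g : LTwo T) {ψ : Pt → ℝ} (h : MemLp ψ 2 (bodyMeasure T)) :
    pairing T (f + g) ψ = pairing T f ψ + pairing T g ψ := by
  unfold pairing
  have hf : Integrable (fun x => f x * ψ x) (bodyMeasure T) := (Lp.memLp f).integrable_mul h
  have hg : Integrable (fun x => g x * ψ x) (bodyMeasure T) := (Lp.memLp g).integrable_mul h
  rw [← integral_add hf hg]
  refine integral_congr_ae ?_
  filter_upwards [Lp.coeFn_add f g] with x hx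
  rw [hx, Pi.add_apply, add_mul]

theorem pairing_smul (T : TriMesh) (c : ℝ) (f : LTwo T) (ψ : Pt → ℝ) :
    pairing T (c • f) ψ = c * pairing T f ψ := by
  unfold pairing
  rw [← integral_const_mul]
  refine integral_congr_ae ?_
  filter_upwards [Lp.coeFn_smul c f] with x hx
  rw [hx, Pi.smul_apply, smul_eq_mul, mul_assoc]

/-! The Sobolev spaces are realised as graphs of the weak differential operators: an element is a
field together with its (unique) weak gradient, curl or divergence. -/

/-- Pairs of a vector field and a candidate for its gradient, `(grad U) I J = ∂ U_I / ∂ X_J`. -/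
abbrev GradPair (T : TriMesh) : Type := VecField T × TenField T

/-- Pairs of a tensor field and a candidate for its row-wise (scalar) curl or divergence. -/
abbrev RowPair (T : TriMesh) : Type := TenField T × VecField T

/-- Pairs `(U, G)` for which `∫ U_I ∂_J φ = - ∫ G_IJ φ` for all test functions supported in `s`. -/
def weakGrad (T : TriMesh) (s : Set Pt) : Submodule ℝ (GradPair T) where
  carrier := {w | ∀ φ, IsTest s φ → ∀ i j,
    pairing T (w.1 i) (partialD j φ) = - pairing T (w.2 i j) φ}
  zero_mem' := by
    intro φ _ i j
    simp [pairing_zero]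
  add_mem' := by
    intro a b ha hb φ h i j
    have h1 := ha φ h i j
    have h2 := hb φ h i j
    simp only [Prod.fst_add, Prod.snd_add, Pi.add_apply]
    rw [pairing_add T _ _ (h.memLp_partialD T j), pairing_add T _ _ (h.memLp T), h1, h2]
    ring
  smul_mem' := by
    intro c a ha φ h i j
    have h1 := ha φ h i j
    simp only [Prod.smul_fst, Prod.smul_snd, Pi.smul_apply]
    rw [pairing_smul, pairing_smul, h1]
    ring

/-- `[H¹]²`, vector fields on the body with components in `H¹`. -/
def HOne (T : TriMesh) : Submodule ℝ (GradPair T) := weakGrad T T.body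

/-- The fields of `[H¹]²` that vanish on the part of the boundary formed by the edges in `Γ`.  The
vanishing of the trace is expressed by Green's formula: there is no boundary term for test functions
that do not vanish on that part of the boundary but vanish near the rest of it. -/
def HOneVanishing (T : TriMesh) (Γ : Finset (Finset Pt)) : Submodule ℝ (GradPair T) :=
  HOne T ⊓ weakGrad T (closure (frontier T.body \ edgeUnion Γ))ᶜ

/-- `H^c`, tensor fields with row-wise curl `∂_1 S_I2 - ∂_2 S_I1` in `L²` (indices `0`, `1` here). -/
def HCurl (T : TriMesh) : Submodule ℝ (RowPair T) where
  carrier := {w | ∀ φ, IsTest T.body φ → ∀ i,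
    pairing T (w.1 i 1) (partialD 0 φ) - pairing T (w.1 i 0) (partialD 1 φ) =
      - pairing T (w.2 i) φ}
  zero_mem' := by
    intro φ _ i
    simp [pairing_zero]
  add_mem' := by
    intro a b ha hb φ h i
    have h1 := ha φ h i
    have h2 := hb φ h i
    simp only [Prod.fst_add, Prod.snd_add, Pi.add_apply]
    rw [pairing_add T _ _ (h.memLp_partialD T 0), pairing_add T _ _ (h.memLp_partialD T 1),
      pairing_add T _ _ (h.memLp T)]
    linarith
  smul_mem' := by
    intro c a ha φ h i
    have h1 := ha φ h i
    simp only [Prod.smul_fst, Prod.smul_snd, Pi.smul_apply]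
    rw [pairing_smul, pairing_smul, pairing_smul, ← mul_sub, h1]
    ring

/-- `H^d`, tensor fields with row-wise divergence `∂_1 S_I1 + ∂_2 S_I2` in `L²`. -/
def HDivg (T : TriMesh) : Submodule ℝ (RowPair T) where
  carrier := {w | ∀ φ, IsTest T.body φ → ∀ i,
    pairing T (w.1 i 0) (partialD 0 φ) + pairing T (w.1 i 1) (partialD 1 φ) =
      - pairing T (w.2 i) φ}
  zero_mem' := by
    intro φ _ i
    simp [pairing_zero]
  add_mem' := by
    intro a b ha hb φ h i
    have h1 := ha φ h i
    have h2 := hb φ h i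
    simp only [Prod.fst_add, Prod.snd_add, Pi.add_apply]
    rw [pairing_add T _ _ (h.memLp_partialD T 0), pairing_add T _ _ (h.memLp_partialD T 1),
      pairing_add T _ _ (h.memLp T)]
    linarith
  smul_mem' := by
    intro c a ha φ h i
    have h1 := ha φ h i
    simp only [Prod.smul_fst, Prod.smul_snd, Pi.smul_apply]
    rw [pairing_smul, pairing_smul, pairing_smul, ← mul_add, h1]
    ring

/-! The finite elements. -/

/-- Polynomials in the two Cartesian coordinates. -/
abbrev Poly2 : Type := MvPolynomial (Fin 2) ℝ

/-- The value of a polynomial at a point. -/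
def evalAt (x : Pt) : Poly2 →+* ℝ := MvPolynomial.eval (fun i => x i)

theorem evalAt_smul (x : Pt) (c : ℝ) (q : Poly2) : evalAt x (c • q) = c * evalAt x q := by
  simp [evalAt, MvPolynomial.smul_eval]

/-- An `L²` function that agrees on every element with the polynomial given for that element. -/
def IsPiecewise (T : TriMesh) (f : LTwo T) (w : Finset Pt → Poly2) : Prop :=
  ∀ K ∈ T.cells, ∀ᵐ x ∂(bodyMeasure T), x ∈ convexHull ℝ (K : Set Pt) → f x = evalAt x (w K)

theorem IsPiecewise.zero (T : TriMesh) : IsPiecewise T 0 (fun _ => 0) := by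
  intro K _
  filter_upwards [Lp.coeFn_zero ℝ 2 (bodyMeasure T)] with x hx _
  rw [hx]
  simp

theorem IsPiecewise.add {T : TriMesh} {f g : LTwo T} {v w : Finset Pt → Poly2}
    (hf : IsPiecewise T f v) (hg : IsPiecewise T g w) :
    IsPiecewise T (f + g) (fun K => v K + w K) := by
  intro K hK
  filter_upwards [hf K hK, hg K hK, Lp.coeFn_add f g] with x h1 h2 h3 hx
  rw [h3, Pi.add_apply, h1 hx, h2 hx, map_add]

theorem IsPiecewise.smul {T : TriMesh} (c : ℝ) {f : LTwo T} {w : Finset Pt → Poly2}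
    (hf : IsPiecewise T f w) : IsPiecewise T (c • f) (fun K => c • w K) := by
  intro K hK
  filter_upwards [hf K hK, Lp.coeFn_smul c f] with x h1 h3 hx
  rw [h3, Pi.smul_apply, smul_eq_mul, h1 hx, evalAt_smul]

/-- The elements `D0`, `D1`, `D2`, …: piecewise polynomials of degree at most `k`, without any
continuity. -/
def elemD (T : TriMesh) (k : ℕ) : Submodule ℝ (LTwo T) where
  carrier := {f | ∃ w : Finset Pt → Poly2,
    (∀ K ∈ T.cells, w K ∈ MvPolynomial.restrictTotalDegree (Fin 2) ℝ k) ∧ IsPiecewise T f w}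
  zero_mem' := ⟨fun _ => 0, fun _ _ => Submodule.zero_mem _, IsPiecewise.zero T⟩
  add_mem' := by
    rintro a b ⟨v, hv, hv'⟩ ⟨w, hw, hw'⟩
    exact ⟨fun K => v K + w K, fun K hK => Submodule.add_mem _ (hv K hK) (hw K hK), hv'.add hw'⟩
  smul_mem' := by
    rintro c a ⟨v, hv, hv'⟩
    exact ⟨fun K => c • v K, fun K hK => Submodule.smul_mem _ c (hv K hK), hv'.smul c⟩

/-- Scalar Lagrange functions of degree `k` with their gradients: polynomials of degree at most `k`
on the elements that agree on the intersection of any two elements. -/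
def lagrangeScalar (T : TriMesh) (k : ℕ) : Submodule ℝ (LTwo T × VecField T) where
  carrier := {u | ∃ w : Finset Pt → Poly2,
    (∀ K ∈ T.cells, w K ∈ MvPolynomial.restrictTotalDegree (Fin 2) ℝ k) ∧
    (∀ K ∈ T.cells, ∀ K' ∈ T.cells,
      ∀ x ∈ convexHull ℝ (K : Set Pt) ∩ convexHull ℝ (K' : Set Pt),
        evalAt x (w K) = evalAt x (w K')) ∧
    IsPiecewise T u.1 w ∧ ∀ j, IsPiecewise T (u.2 j) (fun K => MvPolynomial.pderiv j (w K))}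
  zero_mem' := by
    refine ⟨fun _ => 0, fun _ _ => Submodule.zero_mem _, fun _ _ _ _ _ _ => rfl,
      IsPiecewise.zero T, fun j => ?_⟩
    simpa using IsPiecewise.zero T
  add_mem' := by
    rintro a b ⟨v, hv, hvc, hv', hvd⟩ ⟨w, hw, hwc, hw', hwd⟩
    refine ⟨fun K => v K + w K, fun K hK => Submodule.add_mem _ (hv K hK) (hw K hK), ?_,
      hv'.add hw', fun j => ?_⟩
    · intro K hK K' hK' x hx
      simp [hvc K hK K' hK' x hx, hwc K hK K' hK' x hx]
    · simpa using (hvd j).add (hwd j)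
  smul_mem' := by
    rintro c a ⟨v, hv, hvc, hv', hvd⟩
    refine ⟨fun K => c • v K, fun K hK => Submodule.smul_mem _ c (hv K hK), ?_,
      hv'.smul c, fun j => ?_⟩
    · intro K hK K' hK' x hx
      simp [evalAt_smul, hvc K hK K' hK' x hx]
    · simpa using (hvd j).smul c

/-- The elements `L1`, `L2`, …: vector fields with Lagrange components of degree `k`. -/
def elemL (T : TriMesh) (k : ℕ) : Submodule ℝ (GradPair T) where
  carrier := {w | ∀ i, (w.1 i, w.2 i) ∈ lagrangeScalar T k}
  zero_mem' := fun _ => Submodule.zero_mem _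
  add_mem' := fun ha hb i => Submodule.add_mem _ (ha i) (hb i)
  smul_mem' := fun c _ ha i => Submodule.smul_mem _ c (ha i)

/-- The shape functions `(a₀ - b X₁, a₁ + b X₀)` of the lowest-order Nédélec element of the first
kind. -/
def nedelecShape : Submodule ℝ (Fin 2 → Poly2) :=
  Submodule.span ℝ {![1, 0], ![0, 1], ![-MvPolynomial.X 1, MvPolynomial.X 0]}

/-- The shape functions `(a₀ + b X₀, a₁ + b X₁)` of the lowest-order Raviart-Thomas element. -/
def raviartThomasShape : Submodule ℝ (Fin 2 → Poly2) :=
  Submodule.span ℝ {![1, 0], ![0, 1], ![MvPolynomial.X 0, MvPolynomial.X 1]}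

/-- The lowest-order Nédélec vector fields of the first kind, with their curls: the tangential
component is continuous across the edges. -/
def nedelecVector (T : TriMesh) : Submodule ℝ (VecField T × LTwo T) where
  carrier := {u | ∃ w : Finset Pt → Fin 2 → Poly2,
    (∀ K ∈ T.cells, w K ∈ nedelecShape) ∧
    (∀ K ∈ T.cells, ∀ K' ∈ T.cells, ∀ a b : Pt, a ∈ K → a ∈ K' → b ∈ K → b ∈ K' →
      ∀ x ∈ segment ℝ a b,
        evalAt x (w K 0) * (b 0 - a 0) + evalAt x (w K 1) * (b 1 - a 1) =
          evalAt x (w K' 0) * (b 0 - a 0) + evalAt x (w K' 1) * (b 1 - a 1)) ∧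
    (∀ j, IsPiecewise T (u.1 j) (fun K => w K j)) ∧
    IsPiecewise T u.2
      (fun K => MvPolynomial.pderiv 0 (w K 1) - MvPolynomial.pderiv 1 (w K 0))}
  zero_mem' := by
    refine ⟨fun _ => 0, fun _ _ => Submodule.zero_mem _, fun _ _ _ _ _ _ _ _ _ _ _ _ => rfl,
      fun j => IsPiecewise.zero T, ?_⟩
    simpa using IsPiecewise.zero T
  add_mem' := by
    rintro a b ⟨v, hv, hvc, hv', hvd⟩ ⟨w, hw, hwc, hw', hwd⟩
    refine ⟨fun K => v K + w K, fun K hK => Submodule.add_mem _ (hv K hK) (hw K hK), ?_,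
      fun j => (hv' j).add (hw' j), ?_⟩
    · intro K hK K' hK' p q h1 h2 h3 h4 x hx
      have e1 := hvc K hK K' hK' p q h1 h2 h3 h4 x hx
      have e2 := hwc K hK K' hK' p q h1 h2 h3 h4 x hx
      simp only [Pi.add_apply, map_add]
      linarith
    · have := hvd.add hwd
      simpa [add_sub_add_comm] using this
  smul_mem' := by
    rintro c a ⟨v, hv, hvc, hv', hvd⟩
    refine ⟨fun K => c • v K, fun K hK => Submodule.smul_mem _ c (hv K hK), ?_,
      fun j => (hv' j).smul c, ?_⟩
    · intro K hK K' hK' p q h1 h2 h3 h4 x hx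
      have e1 := hvc K hK K' hK' p q h1 h2 h3 h4 x hx
      simp only [Pi.smul_apply, evalAt_smul]
      linear_combination c * e1
    · have := hvd.smul c
      simpa [smul_sub] using this

/-- The lowest-order Raviart-Thomas vector fields, with their divergences: the normal component is
continuous across the edges. -/
def raviartThomasVector (T : TriMesh) : Submodule ℝ (VecField T × LTwo T) where
  carrier := {u | ∃ w : Finset Pt → Fin 2 → Poly2,
    (∀ K ∈ T.cells, w K ∈ raviartThomasShape) ∧
    (∀ K ∈ T.cells, ∀ K' ∈ T.cells, ∀ a b : Pt, a ∈ K → a ∈ K' → b ∈ K → b ∈ K' →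
      ∀ x ∈ segment ℝ a b,
        evalAt x (w K 0) * (b 1 - a 1) - evalAt x (w K 1) * (b 0 - a 0) =
          evalAt x (w K' 0) * (b 1 - a 1) - evalAt x (w K' 1) * (b 0 - a 0)) ∧
    (∀ j, IsPiecewise T (u.1 j) (fun K => w K j)) ∧
    IsPiecewise T u.2
      (fun K => MvPolynomial.pderiv 0 (w K 0) + MvPolynomial.pderiv 1 (w K 1))}
  zero_mem' := by
    refine ⟨fun _ => 0, fun _ _ => Submodule.zero_mem _, fun _ _ _ _ _ _ _ _ _ _ _ _ => rfl,
      fun j => IsPiecewise.zero T, ?_⟩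
    simpa using IsPiecewise.zero T
  add_mem' := by
    rintro a b ⟨v, hv, hvc, hv', hvd⟩ ⟨w, hw, hwc, hw', hwd⟩
    refine ⟨fun K => v K + w K, fun K hK => Submodule.add_mem _ (hv K hK) (hw K hK), ?_,
      fun j => (hv' j).add (hw' j), ?_⟩
    · intro K hK K' hK' p q h1 h2 h3 h4 x hx
      have e1 := hvc K hK K' hK' p q h1 h2 h3 h4 x hx
      have e2 := hwc K hK K' hK' p q h1 h2 h3 h4 x hx
      simp only [Pi.add_apply, map_add]
      linarith
    · have := hvd.add hwd
      simpa [add_add_add_comm] using this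
  smul_mem' := by
    rintro c a ⟨v, hv, hvc, hv', hvd⟩
    refine ⟨fun K => c • v K, fun K hK => Submodule.smul_mem _ c (hv K hK), ?_,
      fun j => (hv' j).smul c, ?_⟩
    · intro K hK K' hK' p q h1 h2 h3 h4 x hx
      have e1 := hvc K hK K' hK' p q h1 h2 h3 h4 x hx
      simp only [Pi.smul_apply, evalAt_smul]
      linear_combination c * e1
    · have := hvd.smul c
      simpa [smul_add] using this

/-- The element `N11`: tensor fields whose rows are lowest-order Nédélec fields of the first
kind. -/
def elemN11 (T : TriMesh) : Submodule ℝ (RowPair T) where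
  carrier := {w | ∀ i, (w.1 i, w.2 i) ∈ nedelecVector T}
  zero_mem' := fun _ => Submodule.zero_mem _
  add_mem' := fun ha hb i => Submodule.add_mem _ (ha i) (hb i)
  smul_mem' := fun c _ ha i => Submodule.smul_mem _ c (ha i)

/-- The element `R1`: tensor fields whose rows are lowest-order Raviart-Thomas fields. -/
def elemR1 (T : TriMesh) : Submodule ℝ (RowPair T) where
  carrier := {w | ∀ i, (w.1 i, w.2 i) ∈ raviartThomasVector T}
  zero_mem' := fun _ => Submodule.zero_mem _
  add_mem' := fun ha hb i => Submodule.add_mem _ (ha i) (hb i)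
  smul_mem' := fun c _ ha i => Submodule.smul_mem _ c (ha i)

/-! The four-field method. -/

/-- Quadruples (displacement, displacement gradient, stress, pressure). -/
abbrev Quad (T : TriMesh) : Type := GradPair T × RowPair T × RowPair T × LTwo T

namespace Quad

variable {T : TriMesh}

/-- The displacement. -/
def disp (z : Quad T) : VecField T := z.1.1
/-- The gradient of the displacement field. -/
def gradDisp (z : Quad T) : TenField T := z.1.2
/-- The independent displacement-gradient unknown. -/
def dgrad (z : Quad T) : TenField T := z.2.1.1
/-- The curl of the displacement-gradient unknown. -/
def curlDgrad (z : Quad T) : VecField T := z.2.1.2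
/-- The stress. -/
def stress (z : Quad T) : TenField T := z.2.2.1.1
/-- The divergence of the stress. -/
def divStress (z : Quad T) : VecField T := z.2.2.1.2
/-- The pressure. -/
def press (z : Quad T) : LTwo T := z.2.2.2

/-- The Hilbert norm of `[H¹]² × H^c × H^d × L²`. -/
def normZ (z : Quad T) : ℝ :=
  Real.sqrt ((∑ i, ‖z.disp i‖ ^ 2) + (∑ i, ∑ j, ‖z.gradDisp i j‖ ^ 2)
    + (∑ i, ∑ j, ‖z.dgrad i j‖ ^ 2) + (∑ i, ‖z.curlDgrad i‖ ^ 2)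
    + (∑ i, ∑ j, ‖z.stress i j‖ ^ 2) + (∑ i, ‖z.divStress i‖ ^ 2) + ‖z.press‖ ^ 2)

end Quad

/-- The value of a tensor field at a point, as a matrix. -/
def matAt {T : TriMesh} (S : TenField T) (x : Pt) : Mat2 := Matrix.of fun i j => S i j x

/-- The inner product `S^{IJ} T^{IJ}` of second-order tensors. -/
def frob (X Y : Mat2) : ℝ := ∑ i, ∑ j, X i j * Y i j

/-- The `L²` inner product of tensor fields. -/
def tenInner {T : TriMesh} (S R : TenField T) : ℝ :=
  ∫ x, frob (matAt S x) (matAt R x) ∂(bodyMeasure T)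

/-- The deformation gradient `I + K` of a state at a point. -/
def defGrad {T : TriMesh} (u : Quad T) (x : Pt) : Mat2 := 1 + matAt u.dgrad x

/-- The integrand `(A(K) : M) : π`. -/
def elasticIntegrand {T : TriMesh} (A : Mat2 → Mat2 →ₗ[ℝ] Mat2) (u z y : Quad T) (x : Pt) : ℝ :=
  frob (A (matAt u.dgrad x) (matAt z.dgrad x)) (matAt y.stress x)

/-- The integrand `p (I + K)^{-T} Mᵀ (I + K)^{-T} : π`. -/
def pressureIntegrand {T : TriMesh} (u z y : Quad T) (x : Pt) : ℝ :=
  frob (u.press x •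
    (((defGrad u x)⁻¹).transpose * (matAt z.dgrad x).transpose * ((defGrad u x)⁻¹).transpose))
    (matAt y.stress x)

/-- The integrand `r (I + K)^{-T} : π`. -/
def couplingIntegrand {T : TriMesh} (u z y : Quad T) (x : Pt) : ℝ :=
  frob (z.press x • ((defGrad u x)⁻¹).transpose) (matAt y.stress x)

/-- The integrand `det (I + K) tr ((I + K)^{-1} M) q`. -/
def volumeIntegrand {T : TriMesh} (u z y : Quad T) (x : Pt) : ℝ :=
  (defGrad u x).det * ((defGrad u x)⁻¹ * matAt z.dgrad x).trace * y.press x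

/-- The bilinear form `b(z, y; u)` of Newton's iteration at the state `u`, for `z = (V, M, Q, r)` and
`y = (Υ, λ, π, q)`; `A` is the elasticity tensor as a function of the displacement gradient. -/
def newtonForm {T : TriMesh} (A : Mat2 → Mat2 →ₗ[ℝ] Mat2) (u z y : Quad T) : ℝ :=
  tenInner z.stress y.gradDisp
    + tenInner z.gradDisp y.dgrad - tenInner z.dgrad y.dgrad
    + (∫ x, elasticIntegrand A u z y x ∂(bodyMeasure T)) - tenInner z.stress y.stress
    + (∫ x, pressureIntegrand u z y x ∂(bodyMeasure T))
    - (∫ x, couplingIntegrand u z y x ∂(bodyMeasure T))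
    + (∫ x, volumeIntegrand u z y x ∂(bodyMeasure T))

/-- A choice of conforming finite element spaces for the four unknowns: finite-dimensional
subspaces of `[H¹]²`, `H^c`, `H^d` and `L²`. -/
structure FEChoice (T : TriMesh) where
  V1 : Submodule ℝ (GradPair T)
  Vc : Submodule ℝ (RowPair T)
  Vd : Submodule ℝ (RowPair T)
  VD : Submodule ℝ (LTwo T)
  conf1 : V1 ≤ HOne T
  confc : Vc ≤ HCurl T
  confd : Vd ≤ HDivg T
  fin1 : FiniteDimensional ℝ V1
  finc : FiniteDimensional ℝ Vc
  find : FiniteDimensional ℝ Vd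
  finD : FiniteDimensional ℝ VD

namespace FEChoice

variable {T : TriMesh}

/-- The discrete displacements that vanish on the edges in `Γ`. -/
def V1van (F : FEChoice T) (Γ : Finset (Finset Pt)) : Submodule ℝ (GradPair T) :=
  F.V1 ⊓ HOneVanishing T Γ

/-- The trial and test space `Z_h` of the linear problem in Newton's iteration. -/
def Zh (F : FEChoice T) (Γ : Finset (Finset Pt)) : Submodule ℝ (Quad T) :=
  (F.V1van Γ).prod (F.Vc.prod (F.Vd.prod F.VD))

/-- The dimension of the space of discrete displacements that vanish on `Γ`. -/
def n1 (F : FEChoice T) (Γ : Finset (Finset Pt)) : ℕ := Module.finrank ℝ (F.V1van Γ)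
/-- The dimension of the space of discrete displacement gradients. -/
def nc (F : FEChoice T) : ℕ := Module.finrank ℝ F.Vc
/-- The dimension of the space of discrete stresses. -/
def nd (F : FEChoice T) : ℕ := Module.finrank ℝ F.Vd
/-- The dimension of the space of discrete pressures. -/
def nD (F : FEChoice T) : ℕ := Module.finrank ℝ F.VD

/-- The state `u` is such that `b(·, ·; u)` makes sense on `Z_h`: `I + K` is invertible almost
everywhere, and the integrands with coefficients depending on `u` are integrable. -/
structure Admissible (F : FEChoice T) (Γ : Finset (Finset Pt)) (A : Mat2 → Mat2 →ₗ[ℝ] Mat2)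
    (u : Quad T) : Prop where
  invertible : ∀ᵐ x ∂(bodyMeasure T), (defGrad u x).det ≠ 0
  elastic : ∀ z ∈ F.Zh Γ, ∀ y ∈ F.Zh Γ, Integrable (elasticIntegrand A u z y) (bodyMeasure T)
  pressure : ∀ z ∈ F.Zh Γ, ∀ y ∈ F.Zh Γ, Integrable (pressureIntegrand u z y) (bodyMeasure T)
  coupling : ∀ z ∈ F.Zh Γ, ∀ y ∈ F.Zh Γ, Integrable (couplingIntegrand u z y) (bodyMeasure T)
  volume : ∀ z ∈ F.Zh Γ, ∀ y ∈ F.Zh Γ, Integrable (volumeIntegrand u z y) (bodyMeasure T)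

/-- The inf-sup condition with constant `α`; infimum and supremum run over the nonzero elements of
`Z_h` and are taken in the extended reals. -/
def InfSup (F : FEChoice T) (Γ : Finset (Finset Pt)) (A : Mat2 → Mat2 →ₗ[ℝ] Mat2)
    (u : Quad T) (α : ℝ) : Prop :=
  (α : EReal) ≤ ⨅ y : {y : Quad T // y ∈ F.Zh Γ ∧ y ≠ 0},
    ⨆ z : {z : Quad T // z ∈ F.Zh Γ ∧ z ≠ 0},
      ((newtonForm A u z.1 y.1 / (z.1.normZ * y.1.normZ) : ℝ) : EReal)

/-- `z` solves the linear problem `b(z, y; u) = ℓ(y)` for all `y` in `Z_h`. -/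
def SolvesNewton (F : FEChoice T) (Γ : Finset (Finset Pt)) (A : Mat2 → Mat2 →ₗ[ℝ] Mat2)
    (u : Quad T) (ℓ : Quad T → ℝ) (z : Quad T) : Prop :=
  z ∈ F.Zh Γ ∧ ∀ y ∈ F.Zh Γ, newtonForm A u z y = ℓ y

end FEChoice

/-- The space `[H¹]² × H^c × H^d × L²` of states. -/
def states (T : TriMesh) : Submodule ℝ (Quad T) :=
  (HOne T).prod ((HCurl T).prod ((HDivg T).prod ⊤))

end

/-! The discrete problem is square, so a nonzero test function y with b(z, y; u) = 0 for all trial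
functions z spoils both properties at once: the supremum for this y is not positive, and the form
also has a nonzero kernel on the trial side, which can be added to any solution. Such a y comes from
counting. Take a space of test functions for which b depends on z only through some of its
components; if that space has a larger dimension than the space of these components, it contains a
nonzero y that annihilates every z (`unstable_of_finrank_lt`). For y = (Υ, 0, 0, 0) only Q matters,
which settles (i); for y = (0, 0, 0, q) only M matters, which settles (ii); for y = (0, λ, 0, q)
only V and M matter, and n_c cancels from n_c + n_D > n_1 + n_c, which settles (iv). The patterns
lead to (i), (ii), (iv) and (iv); inequality (iii) never has to be used.

The inequalities come from counting degrees of freedom. A row of an N11 field is determined by one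
tangential value per edge, and a rotation embeds R1 into N11, so both have dimension at most 2 N_e,
where N_e is the number of edges. The hierarchical basis of L2 contributes two fields for each
vertex off Γ₁ and for each edge not in Γ₁. D1 and D2 have at least 3 and 6 dimensions per element.
If N_el ≥ 2, some edge is shared, so N_e < 3 N_el. Finally L1 has at most two dimensions per vertex,
and N_v ≤ N_el + 2: finitely many points do not separate a connected open set of the plane, so the
elements can be collected one at a time through common edges (`TriMesh.exists_adjacent`), each
bringing at most one new vertex.

The boundary condition is weak: Green's formula holds without a boundary term. The upper bound for
L1 needs that this forces the values at the ends of the edges in Γ₁ to vanish, which is seen by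
testing with a bump divided by the polynomial (`evalAt_eq_zero_of_green`). The lower bound for L2
needs the converse (`green_of_vanishing`): the product with a test function, extended by zero, is
Lipschitz with compact support, so its derivatives have integral zero. -/

noncomputable section

/-! ### Triangles and barycentric coordinates -/

/-- A nondegenerate triangle, given by its vertex set. -/
structure IsTriangle (K : Finset Pt) : Prop where
  card_eq : K.card = 3
  indep : AffineIndependent ℝ ((↑) : K → Pt)

theorem TriMesh.isTriangle (T : TriMesh) {K : Finset Pt} (hK : K ∈ T.cells) : IsTriangle K :=
  ⟨T.card_eq K hK, T.indep K hK⟩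

/-- The vertices of a triangle as an affine basis of the plane. -/
def IsTriangle.basis {K : Finset Pt} (h : IsTriangle K) : AffineBasis K ℝ Pt :=
  ⟨(↑), h.indep, by
    rw [h.indep.affineSpan_eq_top_iff_card_eq_finrank_add_one]
    simp [h.card_eq]⟩

@[simp] theorem IsTriangle.basis_apply {K : Finset Pt} (h : IsTriangle K) (a : K) :
    h.basis a = a := rfl

theorem IsTriangle.range_basis {K : Finset Pt} (h : IsTriangle K) :
    Set.range h.basis = (K : Set Pt) := by
  ext a
  simp

open Classical in
/-- The barycentric coordinate of the vertex `v` of the triangle `K`, and zero if `v` is not a vertex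
of `K`. -/
def bary (K : Finset Pt) (v : Pt) : Pt →ᵃ[ℝ] ℝ :=
  if h : IsTriangle K ∧ v ∈ K then h.1.basis.coord ⟨v, h.2⟩ else 0

theorem IsTriangle.bary_eq {K : Finset Pt} (h : IsTriangle K) (v : K) :
    bary K v = h.basis.coord v := by
  rw [bary, dif_pos ⟨h, v.2⟩]

theorem bary_of_notMem {K : Finset Pt} {v : Pt} (h : v ∉ K) : bary K v = 0 := by
  rw [bary, dif_neg (fun h' => h h'.2)]

theorem IsTriangle.bary_self {K : Finset Pt} (h : IsTriangle K) {v : Pt} (hv : v ∈ K) :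
    bary K v v = 1 := by
  rw [h.bary_eq ⟨v, hv⟩]
  exact h.basis.coord_apply_eq ⟨v, hv⟩

theorem IsTriangle.bary_of_ne {K : Finset Pt} (h : IsTriangle K) {v a : Pt} (ha : a ∈ K)
    (hav : a ≠ v) : bary K v a = 0 := by
  by_cases hv : v ∈ K
  · rw [h.bary_eq ⟨v, hv⟩]
    exact h.basis.coord_apply_ne (i := ⟨v, hv⟩) (j := ⟨a, ha⟩) (fun e => hav (by
      simpa using (congrArg Subtype.val e).symm))
  · rw [bary_of_notMem hv]; rfl

theorem IsTriangle.mem_convexHull {K : Finset Pt} (h : IsTriangle K) {x : Pt} :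
    x ∈ convexHull ℝ (K : Set Pt) ↔ ∀ v ∈ K, 0 ≤ bary K v x := by
  rw [← h.range_basis, AffineBasis.convexHull_eq_nonneg_coord]
  constructor
  · intro hx v hv
    rw [h.bary_eq ⟨v, hv⟩]; exact hx _
  · intro hx v
    rw [← h.bary_eq]; exact hx v v.2

theorem IsTriangle.mem_interior {K : Finset Pt} (h : IsTriangle K) {x : Pt} :
    x ∈ interior (convexHull ℝ (K : Set Pt)) ↔ ∀ v ∈ K, 0 < bary K v x := by
  rw [← h.range_basis, AffineBasis.interior_convexHull]
  constructor
  · intro hx v hv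
    rw [h.bary_eq ⟨v, hv⟩]; exact hx _
  · intro hx v
    rw [← h.bary_eq]; exact hx v v.2

theorem IsTriangle.sum_bary {K : Finset Pt} (h : IsTriangle K) (x : Pt) :
    ∑ v ∈ K, bary K v x = 1 := by
  rw [← h.basis.sum_coord_apply_eq_one x, ← Finset.sum_coe_sort]
  exact Finset.sum_congr rfl fun v _ => by rw [h.bary_eq]

theorem IsTriangle.sum_bary_smul {K : Finset Pt} (h : IsTriangle K) (x : Pt) :
    ∑ v ∈ K, bary K v x • v = x := by
  conv_rhs => rw [← h.basis.linear_combination_coord_eq_self x]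
  rw [← Finset.sum_coe_sort]
  exact Finset.sum_congr rfl fun v _ => by rw [h.bary_eq]; rfl

theorem IsTriangle.interior_nonempty {K : Finset Pt} (h : IsTriangle K) :
    (interior (convexHull ℝ (K : Set Pt))).Nonempty := by
  rw [← h.range_basis]
  exact interior_convexHull_nonempty_iff_affineSpan_eq_top.2 h.basis.tot

theorem isClosed_hull (K : Finset Pt) : IsClosed (convexHull ℝ (K : Set Pt)) :=
  (K.finite_toSet.isCompact_convexHull (𝕜 := ℝ)).isClosed

theorem isCompact_hull (K : Finset Pt) : IsCompact (convexHull ℝ (K : Set Pt)) :=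
  K.finite_toSet.isCompact_convexHull (𝕜 := ℝ)

theorem IsTriangle.closure_interior {K : Finset Pt} (h : IsTriangle K) :
    closure (interior (convexHull ℝ (K : Set Pt))) = convexHull ℝ (K : Set Pt) := by
  rw [(convex_convexHull ℝ (K : Set Pt)).closure_interior_eq_closure_of_nonempty_interior
    h.interior_nonempty, (isClosed_hull K).closure_eq]

/-- Two affine functions that agree on a set agree on its convex hull. -/
theorem affineMap_eq_of_mem_convexHull {f g : Pt →ᵃ[ℝ] ℝ} {s : Set Pt} (h : ∀ a ∈ s, f a = g a)
    {x : Pt} (hx : x ∈ convexHull ℝ s) : f x = g x := by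
  have hc : Convex ℝ {x | f x = g x} := by
    intro a ha b hb s t _ _ hst
    simp only [Set.mem_ofPred_eq] at *
    rw [Convex.combo_affine_apply hst, Convex.combo_affine_apply hst, ha, hb]
  exact convexHull_min h hc hx

theorem bary_eq_zero_of_mem_convexHull {K : Finset Pt} (h : IsTriangle K) {v x : Pt} {s : Set Pt}
    (hs : s ⊆ K) (hv : v ∉ s) (hx : x ∈ convexHull ℝ s) : bary K v x = 0 := by
  have : bary K v x = (0 : Pt →ᵃ[ℝ] ℝ) x := by
    refine affineMap_eq_of_mem_convexHull (fun a ha => ?_) hx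
    rw [h.bary_of_ne (hs ha) (fun e => hv (by rwa [← e]))]; rfl
  simpa using this

/-- Barycentric coordinates in different elements agree where the elements meet. -/
theorem TriMesh.bary_congr (T : TriMesh) {K K' : Finset Pt} (hK : K ∈ T.cells) (hK' : K' ∈ T.cells)
    {x : Pt} (hx : x ∈ convexHull ℝ (K : Set Pt)) (hx' : x ∈ convexHull ℝ (K' : Set Pt)) (v : Pt) :
    bary K v x = bary K' v x := by
  -- Conformity puts x in the hull of the common vertices, where both coordinates are affine; if v
  -- is not a common vertex, both vanish at all of these.
  have hm : x ∈ convexHull ℝ ((K : Set Pt) ∩ (K' : Set Pt)) := by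
    rw [← T.conform K hK K' hK']; exact ⟨hx, hx'⟩
  refine affineMap_eq_of_mem_convexHull (fun a ha => ?_) hm
  by_cases hav : a = v
  · subst hav
    rw [(T.isTriangle hK).bary_self ha.1, (T.isTriangle hK').bary_self ha.2]
  · rw [(T.isTriangle hK).bary_of_ne ha.1 hav, (T.isTriangle hK').bary_of_ne ha.2 hav]

/-- A vertex of K outside K' would have a positive coordinate at x, but the coordinates with respect
to K and K' agree at x, and for K' it is zero by the default value of `bary`. -/
theorem TriMesh.disjoint_interior (T : TriMesh) {K K' : Finset Pt} (hK : K ∈ T.cells)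
    (hK' : K' ∈ T.cells) {x : Pt} (hx : x ∈ interior (convexHull ℝ (K : Set Pt)))
    (hx' : x ∈ convexHull ℝ (K' : Set Pt)) : K = K' := by
  by_contra hne
  obtain ⟨v, hv, hv'⟩ : ∃ v ∈ K, v ∉ K' := by
    by_contra! hsub
    exact hne (Finset.eq_of_subset_of_card_le hsub (by rw [T.card_eq K hK, T.card_eq K' hK']))
  have h1 := (T.isTriangle hK).mem_interior.1 hx v hv
  rw [T.bary_congr hK hK' (interior_subset hx) hx', bary_of_notMem hv'] at h1
  exact lt_irrefl _ h1

/-! ### The meshed set and its boundary -/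

/-- The closed set that is meshed. -/
def TriMesh.closedBody (T : TriMesh) : Set Pt := ⋃ K ∈ T.cells, convexHull ℝ (K : Set Pt)

theorem TriMesh.mem_closedBody {T : TriMesh} {x : Pt} :
    x ∈ T.closedBody ↔ ∃ K ∈ T.cells, x ∈ convexHull ℝ (K : Set Pt) := by
  simp [closedBody]

theorem TriMesh.isCompact_closedBody (T : TriMesh) : IsCompact T.closedBody :=
  T.cells.isCompact_biUnion fun K _ => isCompact_hull K

theorem TriMesh.body_subset (T : TriMesh) : T.body ⊆ T.closedBody := interior_subset

theorem TriMesh.interior_subset_body (T : TriMesh) {K : Finset Pt} (hK : K ∈ T.cells) :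
    interior (convexHull ℝ (K : Set Pt)) ⊆ T.body :=
  interior_mono (Set.subset_biUnion_of_mem (u := fun K : Finset Pt => convexHull ℝ (K : Set Pt)) hK)

theorem TriMesh.isOpen_body (T : TriMesh) : IsOpen T.body := isOpen_interior

/-- Each triangle is the closure of its interior, so passing to the interior of the union loses
nothing that the closure does not restore. -/
theorem TriMesh.closure_body (T : TriMesh) : closure T.body = T.closedBody := by
  apply subset_antisymm
  · exact closure_minimal T.body_subset T.isCompact_closedBody.isClosed
  · intro x hx
    obtain ⟨K, hK, hx⟩ := TriMesh.mem_closedBody.1 hx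
    rw [← (T.isTriangle hK).closure_interior] at hx
    exact closure_mono (T.interior_subset_body hK) hx

theorem TriMesh.frontier_body (T : TriMesh) : frontier T.body = T.closedBody \ T.body := by
  rw [frontier, T.closure_body, T.isOpen_body.interior_eq]

/-- Almost every point lies in the interior of every element to which it belongs. -/
theorem TriMesh.ae_mem_interior (T : TriMesh) :
    ∀ᵐ x ∂(volume : Measure Pt), ∀ K ∈ T.cells, x ∈ convexHull ℝ (K : Set Pt) →
      x ∈ interior (convexHull ℝ (K : Set Pt)) := by
  rw [Filter.eventually_all_finset]
  intro K _
  have h0 := (convex_convexHull ℝ (K : Set Pt)).addHaar_frontier (volume : Measure Pt)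
  have : ∀ᵐ x ∂(volume : Measure Pt), x ∉ frontier (convexHull ℝ (K : Set Pt)) :=
    measure_eq_zero_iff_ae_notMem.1 h0
  filter_upwards [this] with x hx hxK
  by_contra hxi
  exact hx ⟨subset_closure hxK, hxi⟩

/-! Polynomial functions. -/

theorem contDiff_evalAt (q : Poly2) : ContDiff ℝ ∞ (fun x : Pt => evalAt x q) := by
  induction q using MvPolynomial.induction_on with
  | C a => simpa [evalAt] using contDiff_const
  | add p q hp hq => simpa using hp.add hq
  | mul_X p i hp =>
    simp only [map_mul]
    refine hp.mul ?_
    simp only [evalAt, MvPolynomial.eval_X]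
    exact (EuclideanSpace.proj (𝕜 := ℝ) i).contDiff

theorem partialD_evalAt (q : Poly2) (j : Fin 2) (x : Pt) :
    partialD j (fun x : Pt => evalAt x q) x = evalAt x (MvPolynomial.pderiv j q) := by
  have hd : ∀ q : Poly2, DifferentiableAt ℝ (fun x : Pt => evalAt x q) x := fun q =>
    (contDiff_evalAt q).differentiable (by simp) x
  induction q using MvPolynomial.induction_on with
  | C a => simp [evalAt, partialD]
  | add p q hp hq =>
    simp only [partialD, map_add] at *
    rw [fderiv_fun_add (hd p) (hd q)]
    simp [hp, hq]
  | mul_X p i hp =>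
    have hX : HasFDerivAt (fun x : Pt => x i) (EuclideanSpace.proj (𝕜 := ℝ) i) x :=
      (EuclideanSpace.proj (𝕜 := ℝ) i).hasFDerivAt
    have hE : ∀ x : Pt, evalAt x (MvPolynomial.X i) = x i := fun x => by simp [evalAt]
    have hP := (hd p).hasFDerivAt.mul hX
    simp only [partialD] at *
    simp only [map_mul, hE]
    have hP' : HasFDerivAt (fun x : Pt => evalAt x p * x i) _ x := hP
    rw [hP'.fderiv, Derivation.leibniz]
    simp [hp, hE, MvPolynomial.pderiv_X, Pi.single_apply]
    by_cases hij : i = j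
    · subst hij; simp
    · simp [hij]

/-- A ball of the maximum norm is a product of intervals, and a polynomial is determined by its
values on a product of infinite sets. -/
theorem poly_eq_of_eqOn_open {p q : Poly2} {U : Set Pt} (hU : IsOpen U) (hne : U.Nonempty)
    (h : ∀ x ∈ U, evalAt x p = evalAt x q) : p = q := by
  obtain ⟨x, hx⟩ := hne
  have hV : IsOpen ((fun y : Fin 2 → ℝ => (WithLp.toLp 2 y : Pt)) ⁻¹' U) :=
    hU.preimage (PiLp.continuous_toLp 2 _)
  have hxV : (fun i => x i) ∈ ((fun y : Fin 2 → ℝ => (WithLp.toLp 2 y : Pt)) ⁻¹' U) := hx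
  obtain ⟨r, hr, hball⟩ := Metric.isOpen_iff.1 hV _ hxV
  refine MvPolynomial.funext_set (fun i => Metric.ball (x i) r) (fun i => ?_) (fun y hy => ?_)
  · rw [Real.ball_eq_Ioo]
    exact Set.Ioo_infinite (by linarith)
  · have : y ∈ Metric.ball (fun i => x i) r := by
      rw [← ball_pi _ hr] at *
      exact hy
    exact h _ (hball this)

/-- The polynomial of degree one that represents an affine function. -/
def affPoly (f : Pt →ᵃ[ℝ] ℝ) : Poly2 :=
  MvPolynomial.C (f 0) + ∑ i, MvPolynomial.C (f.linear (EuclideanSpace.single i 1)) * MvPolynomial.X i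

theorem evalAt_affPoly (f : Pt →ᵃ[ℝ] ℝ) (x : Pt) : evalAt x (affPoly f) = f x := by
  have hx : x = ∑ i, x i • (EuclideanSpace.single i 1 : Pt) := by
    ext j
    fin_cases j <;> simp
  have h1 : f x = f.linear x + f 0 := by
    simpa using f.map_vadd 0 x
  rw [h1]
  conv_rhs => rw [hx]
  simp [affPoly, evalAt]
  ring

theorem affPoly_mem (f : Pt →ᵃ[ℝ] ℝ) : affPoly f ∈ MvPolynomial.restrictTotalDegree (Fin 2) ℝ 1 := by
  rw [MvPolynomial.mem_restrictTotalDegree]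
  refine (MvPolynomial.totalDegree_add _ _).trans (max_le (by simp) ?_)
  refine MvPolynomial.totalDegree_finsetSum_le fun i _ => ?_
  refine (MvPolynomial.totalDegree_mul _ _).trans ?_
  simp

/-- A polynomial of degree one represents an affine function. -/
theorem exists_affineMap_of_degree_one {q : Poly2}
    (hq : q ∈ MvPolynomial.restrictTotalDegree (Fin 2) ℝ 1) :
    ∃ f : Pt →ᵃ[ℝ] ℝ, ∀ x, evalAt x q = f x := by
  have key : ∀ n ∈ q.support, ∃ f : Pt →ᵃ[ℝ] ℝ,
      ∀ x, evalAt x (MvPolynomial.monomial n (q.coeff n)) = f x := by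
    intro n hn
    have hdeg : n 0 + n 1 ≤ 1 := by
      have h1 := MvPolynomial.le_totalDegree hn
      rw [Finsupp.sum_fintype _ _ (fun _ => rfl), Fin.sum_univ_two] at h1
      exact h1.trans ((MvPolynomial.mem_restrictTotalDegree _ _ _).1 hq)
    have hev : ∀ x : Pt, evalAt x (MvPolynomial.monomial n (q.coeff n)) =
        q.coeff n * (x 0 ^ n 0 * x 1 ^ n 1) := fun x => by
      rw [evalAt, MvPolynomial.eval_monomial, Finsupp.prod_fintype _ _ (fun _ => pow_zero _),
        Fin.prod_univ_two]
    have hcases : (n 0 = 0 ∧ n 1 = 0) ∨ (n 0 = 1 ∧ n 1 = 0) ∨ (n 0 = 0 ∧ n 1 = 1) := by omega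
    rcases hcases with ⟨h0, h1⟩ | ⟨h0, h1⟩ | ⟨h0, h1⟩
    · exact ⟨AffineMap.const ℝ Pt (q.coeff n), fun x => by simp [hev, h0, h1]⟩
    · exact ⟨(q.coeff n • (EuclideanSpace.proj (𝕜 := ℝ) (0 : Fin 2)).toLinearMap).toAffineMap,
        fun x => by simp [hev, h0, h1]⟩
    · exact ⟨(q.coeff n • (EuclideanSpace.proj (𝕜 := ℝ) (1 : Fin 2)).toLinearMap).toAffineMap,
        fun x => by simp [hev, h0, h1]⟩
  choose! g hg using key
  refine ⟨∑ n ∈ q.support, g n, fun x => ?_⟩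
  conv_lhs => rw [q.as_sum]
  rw [map_sum, Finset.sum_congr rfl fun n hn => hg n hn x]
  have : ∀ s : Finset (Fin 2 →₀ ℕ), (∑ n ∈ s, g n) x = ∑ n ∈ s, g n x := fun s => by
    classical
    induction s using Finset.induction_on with
    | empty => simp
    | insert a s ha ih => rw [Finset.sum_insert ha, Finset.sum_insert ha, ← ih]; rfl
  rw [this]

theorem poly_eq_zero_of_degree_one {K : Finset Pt} (h : IsTriangle K) {q : Poly2}
    (hq : q ∈ MvPolynomial.restrictTotalDegree (Fin 2) ℝ 1) (hz : ∀ a ∈ K, evalAt a q = 0) :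
    q = 0 := by
  obtain ⟨f, hf⟩ := exists_affineMap_of_degree_one hq
  refine poly_eq_of_eqOn_open isOpen_interior h.interior_nonempty fun x hx => ?_
  rw [hf, map_zero]
  exact affineMap_eq_of_mem_convexHull (g := 0) (fun a ha => by rw [← hf, hz a ha]; rfl)
    (interior_subset hx)

theorem evalAt_eq_of_ae_eq {U : Set Pt} (hU : IsOpen U) {p q : Poly2}
    (h : ∀ᵐ x ∂(volume.restrict U : Measure Pt), evalAt x p = evalAt x q) :
    ∀ x ∈ U, evalAt x p = evalAt x q := by
  have := Measure.eqOn_open_of_ae_eq (μ := (volume : Measure Pt))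
    (f := fun x : Pt => evalAt x p) (g := fun x : Pt => evalAt x q) h hU
    (contDiff_evalAt p).continuous.continuousOn (contDiff_evalAt q).continuous.continuousOn
  exact fun x hx => this hx

/-! Piecewise polynomials as elements of `L²`. -/

/-- Equality almost everywhere on the interior of an element becomes equality of polynomials by
continuity. Outside `T.cells` the family is unconstrained, hence the hypothesis on K. -/
theorem IsPiecewise.unique {T : TriMesh} {f : LTwo T} {w w' : Finset Pt → Poly2}
    (h : IsPiecewise T f w) (h' : IsPiecewise T f w') {K : Finset Pt} (hK : K ∈ T.cells) :
    w K = w' K := by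
  have hi := (T.isTriangle hK).interior_nonempty
  refine poly_eq_of_eqOn_open isOpen_interior hi (evalAt_eq_of_ae_eq isOpen_interior ?_)
  have hle : (volume.restrict (interior (convexHull ℝ (K : Set Pt))) : Measure Pt) ≤
      bodyMeasure T := Measure.restrict_mono (T.interior_subset_body hK) le_rfl
  filter_upwards [ae_mono hle (h K hK), ae_mono hle (h' K hK),
    ae_restrict_mem isOpen_interior.measurableSet] with x h1 h2 h3
  rw [← h1 (interior_subset h3), h2 (interior_subset h3)]

theorem ae_mem_cell (T : TriMesh) :
    ∀ᵐ x ∂(bodyMeasure T), ∃ K ∈ T.cells, x ∈ interior (convexHull ℝ (K : Set Pt)) := by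
  filter_upwards [ae_restrict_of_ae T.ae_mem_interior, ae_restrict_mem T.isOpen_body.measurableSet]
    with x h1 h2
  obtain ⟨K, hK, hx⟩ := TriMesh.mem_closedBody.1 (T.body_subset h2)
  exact ⟨K, hK, h1 K hK hx⟩

theorem IsPiecewise.unique_left {T : TriMesh} {f g : LTwo T} {w : Finset Pt → Poly2}
    (h : IsPiecewise T f w) (h' : IsPiecewise T g w) : f = g := by
  apply Lp.ext
  have e1 := (Filter.eventually_all_finset T.cells).2 h
  have e2 := (Filter.eventually_all_finset T.cells).2 h'
  filter_upwards [e1, e2, ae_mem_cell T] with x h1 h2 ⟨K, hK, hx⟩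
  rw [h1 K hK (interior_subset hx), h2 K hK (interior_subset hx)]

instance (T : TriMesh) : IsFiniteMeasure (bodyMeasure T) :=
  ⟨by
    rw [bodyMeasure, Measure.restrict_apply_univ]
    exact (measure_mono T.body_subset).trans_lt T.isCompact_closedBody.measure_lt_top⟩

theorem exists_isPiecewise (T : TriMesh) (w : Finset Pt → Poly2) :
    ∃ f : LTwo T, IsPiecewise T f w := by
  -- The interiors of the elements do not overlap, so almost everywhere on an element only its own
  -- summand counts.
  have hm : MemLp (fun x => ∑ K ∈ T.cells,
      (interior (convexHull ℝ (K : Set Pt))).indicator (fun x => evalAt x (w K)) x) 2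
      (bodyMeasure T) := by
    refine memLp_finsetSum _ fun K _ => ?_
    obtain ⟨C, hC⟩ := (isCompact_hull K).exists_bound_of_continuousOn
      (contDiff_evalAt (w K)).continuous.continuousOn
    refine MemLp.of_bound ((contDiff_evalAt (w K)).continuous.measurable.indicator
      isOpen_interior.measurableSet).aestronglyMeasurable (max C 0) (Filter.Eventually.of_forall
        fun x => ?_)
    by_cases hx : x ∈ interior (convexHull ℝ (K : Set Pt))
    · rw [Set.indicator_of_mem hx]
      exact (hC x (interior_subset hx)).trans (le_max_left _ _)
    · rw [Set.indicator_of_notMem hx]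
      simp
  refine ⟨hm.toLp _, fun K hK => ?_⟩
  filter_upwards [hm.coeFn_toLp, ae_restrict_of_ae T.ae_mem_interior] with x h1 h2 hx
  rw [h1, Finset.sum_eq_single K]
  · rw [Set.indicator_of_mem (h2 K hK hx)]
  · intro K' hK' hne
    exact Set.indicator_of_notMem (fun hx' => hne (T.disjoint_interior hK' hK hx' hx)) _
  · exact fun h => absurd hK h

/-- The `L²` function given by a polynomial on every element. -/
def assemble (T : TriMesh) : (Finset Pt → Poly2) →ₗ[ℝ] LTwo T where
  toFun w := (exists_isPiecewise T w).choose
  map_add' v w := (exists_isPiecewise T (v + w)).choose_spec.unique_left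
    ((exists_isPiecewise T v).choose_spec.add (exists_isPiecewise T w).choose_spec)
  map_smul' c w := (exists_isPiecewise T (c • w)).choose_spec.unique_left
    ((exists_isPiecewise T w).choose_spec.smul c)

theorem assemble_spec (T : TriMesh) (w : Finset Pt → Poly2) : IsPiecewise T (assemble T w) w :=
  (exists_isPiecewise T w).choose_spec

open Classical in
/-- Extension by zero of a family of polynomials on the elements. -/
def extendCells (T : TriMesh) : (T.cells → Poly2) →ₗ[ℝ] (Finset Pt → Poly2) where
  toFun w K := if h : K ∈ T.cells then w ⟨K, h⟩ else 0
  map_add' v w := by ext1 K; by_cases h : K ∈ T.cells <;> simp [h]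
  map_smul' c w := by ext1 K; by_cases h : K ∈ T.cells <;> simp [h]

theorem extendCells_apply (T : TriMesh) (w : T.cells → Poly2) (K : T.cells) :
    extendCells T w K = w K := by
  simp [extendCells]

/-- Only families indexed by the elements can be recovered, since the polynomials given for other
vertex sets leave no trace in `L²`. -/
theorem assemble_extendCells_injective (T : TriMesh) :
    Function.Injective (assemble T ∘ₗ extendCells T) := by
  intro v w h
  ext1 K
  rw [← extendCells_apply T v, ← extendCells_apply T w]
  refine (assemble_spec T _).unique (w' := extendCells T w) ?_ K.2
  have h' : assemble T (extendCells T v) = assemble T (extendCells T w) := h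
  rw [h']
  exact assemble_spec T _

open Classical in
/-- The polynomial on the element `K` of a piecewise polynomial `L²` function, as a linear map. -/
def piece (T : TriMesh) (K : Finset Pt) : LTwo T →ₗ[ℝ] Poly2 :=
  if h : K ∈ T.cells then
    LinearMap.proj (φ := fun _ : T.cells => Poly2) ⟨K, h⟩ ∘ₗ (LinearMap.exists_leftInverse_of_injective _
      (LinearMap.ker_eq_bot.2 (assemble_extendCells_injective T))).choose
  else 0

/-- `piece` comes from an arbitrary linear left inverse of assembly, so its values mean something
only on piecewise polynomials. Being defined on all of `L²`, it lets the degrees of freedom be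
written as linear maps. -/
theorem IsPiecewise.piece_eq {T : TriMesh} {f : LTwo T} {w : Finset Pt → Poly2}
    (h : IsPiecewise T f w) {K : Finset Pt} (hK : K ∈ T.cells) : piece T K f = w K := by
  have hf : f = (assemble T ∘ₗ extendCells T) (fun K => w K) := by
    have h1 : IsPiecewise T f (extendCells T fun K => w K) := by
      intro K hK
      simpa [extendCells, hK] using h K hK
    exact h1.unique_left (assemble_spec T _)
  have hl := (LinearMap.exists_leftInverse_of_injective _
      (LinearMap.ker_eq_bot.2 (assemble_extendCells_injective T))).choose_spec
  have h2 := LinearMap.congr_fun hl (fun K => w K)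
  rw [LinearMap.comp_apply, ← hf] at h2
  rw [piece, dif_pos hK, LinearMap.comp_apply, h2]
  rfl

/-! ### Connectivity of the mesh through edges -/

theorem one_lt_rank_pt : 1 < Module.rank ℝ Pt := by
  apply Module.one_lt_rank_of_one_lt_finrank
  simp

/-- A punctured disc is connected. -/
theorem isPreconnected_punctured_ball (x : Pt) {r : ℝ} :
    IsPreconnected (Metric.ball x r \ {x}) := by
  -- Polar coordinates: the punctured disc is a continuous image of a circle times an interval.
  have h1 : IsPreconnected (Metric.sphere (0 : Pt) 1 ×ˢ Set.Ioo 0 r) :=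
    (isPreconnected_sphere one_lt_rank_pt 0 1).prod isPreconnected_Ioo
  have h2 : Continuous fun p : Pt × ℝ => x + p.2 • p.1 := by fun_prop
  convert h1.image _ h2.continuousOn using 1
  ext y
  constructor
  · rintro ⟨hy, hne⟩
    have hn : y - x ≠ 0 := sub_ne_zero.2 hne
    refine ⟨(‖y - x‖⁻¹ • (y - x), ‖y - x‖), ⟨?_, ?_⟩, ?_⟩
    · simp [norm_smul, norm_ne_zero_iff.2 hn]
    · exact ⟨norm_pos_iff.2 hn, by rwa [← dist_eq_norm]⟩
    · simp [smul_smul, norm_ne_zero_iff.2 hn]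
  · rintro ⟨⟨u, t⟩, ⟨hu, ht⟩, rfl⟩
    have hu' : ‖u‖ = 1 := by simpa using hu
    refine ⟨?_, ?_⟩
    · simp [norm_smul, hu', abs_of_pos ht.1, ht.2]
    · have : u ≠ 0 := fun h => by simp [h] at hu'
      simp [this, ht.1.ne']

theorem not_isOpen_of_finite {s : Set Pt} (hs : s.Finite) (hne : s.Nonempty) : ¬ IsOpen s := by
  intro ho
  obtain ⟨x, hx⟩ := hne
  obtain ⟨r, hr, hb⟩ := Metric.isOpen_iff.1 ho x hx
  have h1 := hs.subset hb
  have h2 : (volume : Measure Pt) (Metric.ball x r) = 0 := h1.measure_zero _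
  exact (Metric.measure_ball_pos volume x hr).ne' h2

/-- A connected open set in the plane is not the union of two closed sets that meet in finitely
many points only, unless one of them has no interior in it. -/
theorem eq_empty_of_finite_inter {U A B : Set Pt} (hU : IsOpen U) (hc : IsPreconnected U)
    (hA : IsClosed A) (hB : IsClosed B) (hAB : U ⊆ A ∪ B) (hf : (A ∩ B).Finite)
    (hAi : (U ∩ interior A).Nonempty) (hBi : (U ∩ interior B).Nonempty) : False := by
  -- Around a point of U there is a disc whose punctured part misses A ∩ B. Being connected, the
  -- punctured disc lies in A or in B, and then so does the whole disc, as these sets are closed.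
  have hcov : U ⊆ interior A ∪ interior B := by
    intro x hx
    have hfin : ((A ∩ B) \ {x}).Finite := hf.subset Set.sdiff_subset
    have hopen : IsOpen (U \ ((A ∩ B) \ {x})) := hU.sdiff hfin.isClosed
    obtain ⟨r, hr, hb⟩ := Metric.isOpen_iff.1 hopen x ⟨hx, fun h => h.2 rfl⟩
    have hcl : ∀ C : Set Pt, IsClosed C → Metric.ball x r \ {x} ⊆ C → x ∈ interior C := by
      intro C hC hs
      refine mem_interior.2 ⟨Metric.ball x r, ?_, Metric.isOpen_ball, Metric.mem_ball_self hr⟩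
      have hd : Dense ({x}ᶜ : Set Pt) := dense_compl_singleton x
      have h1 := hd.open_subset_closure_inter (Metric.isOpen_ball (x := x) (ε := r))
      exact h1.trans (closure_minimal hs hC)
    by_contra hcon
    rw [Set.mem_union, not_or] at hcon
    have hD := isPreconnected_punctured_ball x (r := r)
    have hDsub : Metric.ball x r \ {x} ⊆ A ∪ B := fun y hy => hAB (hb hy.1).1
    have hDne : ¬ ((Metric.ball x r \ {x}) ∩ (A ∩ B)).Nonempty := by
      rintro ⟨y, hy, hyAB⟩
      exact (hb hy.1).2 ⟨hyAB, hy.2⟩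
    rw [isPreconnected_closed_iff] at hD
    have hD' := fun h1 h2 => hDne (hD A B hA hB hDsub h1 h2)
    by_cases hDA : ((Metric.ball x r \ {x}) ∩ A).Nonempty
    · by_cases hDB : ((Metric.ball x r \ {x}) ∩ B).Nonempty
      · exact hD' hDA hDB
      · refine hcon.1 (hcl A hA fun y hy => (hDsub hy).resolve_right fun h => hDB ⟨y, hy, h⟩)
    · refine hcon.2 (hcl B hB fun y hy => (hDsub hy).resolve_left fun h => hDA ⟨y, hy, h⟩)
  -- By connectedness the two interiors overlap in U, in a nonempty open subset of the finite set A
  -- ∩ B, which cannot exist.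
  obtain ⟨x, hxU, hxA, hxB⟩ := hc _ _ isOpen_interior isOpen_interior hcov hAi hBi
  have hfin : (U ∩ (interior A ∩ interior B)).Finite :=
    hf.subset fun y hy => ⟨interior_subset hy.2.1, interior_subset hy.2.2⟩
  exact not_isOpen_of_finite hfin ⟨x, hxU, hxA, hxB⟩
    (hU.inter (isOpen_interior.inter isOpen_interior))

open Classical in
/-- The elements of a mesh are connected through common edges. -/
theorem TriMesh.exists_adjacent (T : TriMesh) {S : Finset (Finset Pt)} (hS : S ⊆ T.cells)
    (hne : S.Nonempty) (hlt : S ≠ T.cells) :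
    ∃ K ∈ S, ∃ K' ∈ T.cells \ S, 2 ≤ (K ∩ K').card := by
  by_contra! hcon
  have hclosed : ∀ R : Finset (Finset Pt), IsClosed (⋃ K ∈ R, convexHull ℝ (K : Set Pt)) :=
    fun R => isClosed_biUnion_finset fun K _ => isClosed_hull K
  have hint : ∀ R : Finset (Finset Pt), R ⊆ T.cells → R.Nonempty →
      (T.body ∩ interior (⋃ K ∈ R, convexHull ℝ (K : Set Pt))).Nonempty := by
    rintro R hR ⟨K, hK⟩
    obtain ⟨x, hx⟩ := (T.isTriangle (hR hK)).interior_nonempty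
    exact ⟨x, T.interior_subset_body (hR hK) hx, interior_mono
      (Set.subset_biUnion_of_mem (u := fun K : Finset Pt => convexHull ℝ (K : Set Pt)) hK) hx⟩
  have hne' : (T.cells \ S).Nonempty := by
    rw [Finset.sdiff_nonempty]
    exact fun h => hlt (subset_antisymm hS h)
  -- The two closed sets are the unions of the elements in S and of the others. Elements with at
  -- most one common vertex meet at most there, so the two unions would only meet in vertices of the
  -- mesh.
  refine eq_empty_of_finite_inter T.isOpen_body T.connected.isPreconnected (hclosed S)
    (hclosed (T.cells \ S)) ?_ ?_ (hint S hS hne) (hint _ Finset.sdiff_subset hne')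
  · intro x hx
    obtain ⟨K, hK, hxK⟩ := TriMesh.mem_closedBody.1 (T.body_subset hx)
    by_cases hKS : K ∈ S
    · exact Or.inl (Set.mem_biUnion hKS hxK)
    · exact Or.inr (Set.mem_biUnion (Finset.mem_coe.2 (Finset.mem_sdiff.2 ⟨hK, hKS⟩)) hxK)
  · have hfin : (⋃ K ∈ T.cells, (K : Set Pt)).Finite :=
      T.cells.finite_toSet.biUnion fun K _ => K.finite_toSet
    refine hfin.subset ?_
    rintro x ⟨hx, hx'⟩
    simp only [Set.mem_iUnion] at hx hx'
    obtain ⟨K, hK, hxK⟩ := hx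
    obtain ⟨K', hK', hxK'⟩ := hx'
    have hm : x ∈ convexHull ℝ ((K : Set Pt) ∩ (K' : Set Pt)) := by
      rw [← T.conform K (hS hK) K' (Finset.mem_sdiff.1 hK').1]; exact ⟨hxK, hxK'⟩
    have hcard := hcon K hK K' hK'
    rw [← Finset.coe_inter] at hm
    have hle : (K ∩ K').card ≤ 1 := by omega
    rw [Finset.card_le_one_iff_subset_singleton] at hle
    obtain ⟨a, ha⟩ := hle
    have hxa : x ∈ ((K ∩ K' : Finset Pt) : Set Pt) := by
      rcases Finset.subset_singleton_iff.1 ha with h0 | h0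
      · simp [h0] at hm
      · rw [h0] at hm ⊢; simpa using hm
    exact Set.mem_biUnion (hS hK) (Finset.mem_inter.1 hxa).1

/-! ### Counting vertices and edges -/

/-- The vertices of a mesh as a finite set. -/
def TriMesh.vertexFinset (T : TriMesh) : Finset Pt := open Classical in T.cells.biUnion id

theorem TriMesh.mem_vertexFinset {T : TriMesh} {a : Pt} :
    a ∈ T.vertexFinset ↔ ∃ K ∈ T.cells, a ∈ K := by
  simp [vertexFinset]

theorem TriMesh.coe_vertexFinset (T : TriMesh) : (T.vertexFinset : Set Pt) = T.vertices := by
  ext a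
  rw [Finset.mem_coe, mem_vertexFinset]; rfl

/-- The edges of a mesh as a finite set. -/
def TriMesh.edgeFinset (T : TriMesh) : Finset (Finset Pt) :=
  open Classical in T.cells.biUnion (fun K => K.powersetCard 2)

theorem TriMesh.mem_edgeFinset {T : TriMesh} {e : Finset Pt} :
    e ∈ T.edgeFinset ↔ e.card = 2 ∧ ∃ K ∈ T.cells, e ⊆ K := by
  simp only [edgeFinset, Finset.mem_biUnion, Finset.mem_powersetCard]
  tauto

theorem TriMesh.cells_nonempty (T : TriMesh) : T.cells.Nonempty := by
  obtain ⟨x, hx⟩ := T.connected.nonempty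
  obtain ⟨K, hK, -⟩ := TriMesh.mem_closedBody.1 (T.body_subset hx)
  exact ⟨K, hK⟩

/-- A mesh has at most two vertices more than elements. -/
theorem TriMesh.card_vertexFinset_le (T : TriMesh) :
    T.vertexFinset.card ≤ T.cells.card + 2 := by
  classical
  -- Collect the elements one at a time. The first has 3 = 1 + 2 vertices; each further one can be
  -- chosen to share two vertices with an earlier one, so that it adds at most one.
  have key : ∀ n, 1 ≤ n → n ≤ T.cells.card → ∃ S ⊆ T.cells, S.card = n ∧
      (S.biUnion id).card ≤ n + 2 := by
    intro n hn
    induction n, hn using Nat.le_induction with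
    | base =>
      intro _
      obtain ⟨K, hK⟩ := T.cells_nonempty
      exact ⟨{K}, by simpa using hK, by simp, by simp [T.card_eq K hK]⟩
    | succ n hn ih =>
      intro hle
      obtain ⟨S, hS, hSc, hSv⟩ := ih (by omega)
      obtain ⟨K, hK, K', hK', h2⟩ := T.exists_adjacent hS (Finset.card_pos.1 (by omega))
        (fun h => by rw [h] at hSc; omega)
      rw [Finset.mem_sdiff] at hK'
      refine ⟨insert K' S, Finset.insert_subset hK'.1 hS, by
        rw [Finset.card_insert_of_notMem hK'.2, hSc], ?_⟩
      rw [Finset.biUnion_insert]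
      have h3 := Finset.card_union_add_card_inter (id K') (S.biUnion id)
      have h4 : (K ∩ K').card ≤ (id K' ∩ S.biUnion id).card := by
        refine Finset.card_le_card fun a ha => ?_
        rw [Finset.mem_inter] at ha ⊢
        exact ⟨ha.2, Finset.mem_biUnion.2 ⟨K, hK, ha.1⟩⟩
      have h5 : (id K').card = 3 := T.card_eq K' hK'.1
      omega
  obtain ⟨S, hS, hSc, hSv⟩ := key T.cells.card (Finset.card_pos.2 T.cells_nonempty) le_rfl
  have := Finset.eq_of_subset_of_card_le hS hSc.ge
  rw [this] at hSv
  exact hSv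

/-- A mesh with at least two elements has an interior edge. -/
theorem TriMesh.card_edgeFinset_lt (T : TriMesh) (h2 : 2 ≤ T.cells.card) :
    T.edgeFinset.card < 3 * T.cells.card := by
  classical
  obtain ⟨K₀, hK₀⟩ := T.cells_nonempty
  obtain ⟨K, hK, K', hK', hc⟩ := T.exists_adjacent (S := {K₀}) (by simpa using hK₀) (by simp)
    (fun h => by rw [← h] at h2; simp at h2)
  rw [Finset.mem_sdiff] at hK'
  have hKc : K ∈ T.cells := by rw [Finset.mem_singleton.1 hK]; exact hK₀
  have hne : K ≠ K' := fun h => hK'.2 (h ▸ hK)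
  obtain ⟨e, he, hec⟩ := Finset.exists_subset_card_eq hc
  have hcard : ∀ L ∈ T.cells, (L.powersetCard 2).card = 3 := fun L hL => by
    rw [Finset.card_powersetCard, T.card_eq L hL]; rfl
  -- The common edge e is struck from the list for K because K' already supplies it, which leaves at
  -- most 3 (N_el - 1) + 2 edges.
  have hsub : T.edgeFinset ⊆ ((T.cells.erase K).biUnion fun K => K.powersetCard 2) ∪
      (K.powersetCard 2).erase e := by
    intro e' he'
    rw [mem_edgeFinset] at he'
    obtain ⟨h2, L, hL, heL⟩ := he'
    rw [Finset.mem_union]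
    by_cases hLK : L = K
    · by_cases hee : e' = e
      · left
        rw [Finset.mem_biUnion]
        refine ⟨K', Finset.mem_erase.2 ⟨hne.symm, hK'.1⟩, Finset.mem_powersetCard.2 ⟨?_, h2⟩⟩
        rw [hee]; exact he.trans Finset.inter_subset_right
      · right
        rw [Finset.mem_erase, Finset.mem_powersetCard]
        exact ⟨hee, hLK ▸ heL, h2⟩
    · left
      rw [Finset.mem_biUnion]
      exact ⟨L, Finset.mem_erase.2 ⟨hLK, hL⟩, Finset.mem_powersetCard.2 ⟨heL, h2⟩⟩
  have h3 := (Finset.card_le_card hsub).trans (Finset.card_union_le _ _)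
  have h4 : ((T.cells.erase K).biUnion fun K => K.powersetCard 2).card ≤
      (T.cells.erase K).card * 3 :=
    Finset.card_biUnion_le_card_mul _ _ _ fun L hL => (hcard L (Finset.mem_of_mem_erase hL)).le
  rw [Finset.card_erase_of_mem hKc] at h4
  rw [Finset.card_erase_of_mem (Finset.mem_powersetCard.2
    ⟨he.trans Finset.inter_subset_left, hec⟩), hcard K hKc] at h3
  omega

/-! Linear algebra of square systems. -/

section LinearAlgebra

variable {Z Y W : Type*} [AddCommGroup Z] [Module ℝ Z] [AddCommGroup Y] [Module ℝ Y]
  [AddCommGroup W] [Module ℝ W] [FiniteDimensional ℝ W]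

/-- If the functionals `f y` only depend on a quotient of dimension less than that of `Y`, then one of
them vanishes for some `y ≠ 0`. -/
theorem exists_ne_zero_of_finrank_lt (f : Y →ₗ[ℝ] Module.Dual ℝ Z) (P : Z →ₗ[ℝ] W)
    (hP : ∀ y z, P z = 0 → f y z = 0) (hlt : Module.finrank ℝ W < Module.finrank ℝ Y) :
    ∃ y, y ≠ 0 ∧ f y = 0 := by
  by_contra! hcon
  have hinj : Function.Injective f := by
    rw [← LinearMap.ker_eq_bot, LinearMap.ker_eq_bot']
    intro y hy
    by_contra hne
    exact hcon y hne hy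
  -- Every functional in the range of f vanishes on the kernel of P and so factors through P; this
  -- bounds the rank of f by the dimension of W.
  have hsub : LinearMap.range f ≤ LinearMap.range P.dualMap := by
    rintro _ ⟨y, rfl⟩
    rw [LinearMap.range_dualMap_eq_dualAnnihilator_ker, Submodule.mem_dualAnnihilator]
    exact fun z hz => hP y z hz
  have h1 := LinearMap.finrank_range_of_inj hinj
  have h2 := Submodule.finrank_mono hsub
  have h3 := LinearMap.finrank_range_le P.dualMap
  rw [Subspace.dual_finrank_eq] at h3
  omega

/-- A bilinear form on a finite-dimensional space with a left kernel has a right kernel. -/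
theorem exists_right_kernel {V : Type*} [AddCommGroup V] [Module ℝ V]
    [FiniteDimensional ℝ V] (B : V →ₗ[ℝ] V →ₗ[ℝ] ℝ) {y : V} (hy : y ≠ 0) (h : ∀ z, B z y = 0) :
    ∃ z, z ≠ 0 ∧ B z = 0 := by
  by_contra! hcon
  have hinj : Function.Injective B := by
    rw [← LinearMap.ker_eq_bot, LinearMap.ker_eq_bot']
    intro y hy
    by_contra hne
    exact hcon y hne hy
  -- An injective map from V to its dual is onto by equality of dimensions, and then every
  -- functional vanishes at y.
  have hsurj : Function.Surjective B :=
    (LinearMap.injective_iff_surjective_of_finrank_eq_finrank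
      (Subspace.dual_finrank_eq (K := ℝ) (V := V)).symm).1 hinj
  apply hy
  rw [← Module.forall_dual_apply_eq_zero_iff ℝ y]
  intro φ
  obtain ⟨z, rfl⟩ := hsurj φ
  exact h z

end LinearAlgebra

/-! Bilinearity of the form of Newton's iteration. -/

theorem frob_add_left (X Y Z : Mat2) : frob (X + Y) Z = frob X Z + frob Y Z := by
  simp [frob, add_mul, Finset.sum_add_distrib]

theorem frob_add_right (X Y Z : Mat2) : frob X (Y + Z) = frob X Y + frob X Z := by
  simp [frob, mul_add, Finset.sum_add_distrib]

theorem frob_smul_left (c : ℝ) (X Y : Mat2) : frob (c • X) Y = c * frob X Y := by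
  simp only [frob, Matrix.smul_apply, smul_eq_mul, Fin.sum_univ_two]
  ring

theorem frob_smul_right (c : ℝ) (X Y : Mat2) : frob X (c • Y) = c * frob X Y := by
  simp only [frob, Matrix.smul_apply, smul_eq_mul, Fin.sum_univ_two]
  ring

theorem frob_zero_left (X : Mat2) : frob 0 X = 0 := by simp [frob]

theorem frob_zero_right (X : Mat2) : frob X 0 = 0 := by simp [frob]

theorem matAt_add {T : TriMesh} (S R : TenField T) :
    ∀ᵐ x ∂(bodyMeasure T), matAt (S + R) x = matAt S x + matAt R x := by
  have h : ∀ i j, ∀ᵐ x ∂(bodyMeasure T), (S i j + R i j : LTwo T) x = S i j x + R i j x :=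
    fun i j => Lp.coeFn_add _ _
  filter_upwards [h 0 0, h 0 1, h 1 0, h 1 1] with x h00 h01 h10 h11
  ext i j
  fin_cases i <;> fin_cases j <;> simpa [matAt]

theorem matAt_smul {T : TriMesh} (c : ℝ) (S : TenField T) :
    ∀ᵐ x ∂(bodyMeasure T), matAt (c • S) x = c • matAt S x := by
  have h : ∀ i j, ∀ᵐ x ∂(bodyMeasure T), (c • S i j : LTwo T) x = c * S i j x :=
    fun i j => Lp.coeFn_smul _ _
  filter_upwards [h 0 0, h 0 1, h 1 0, h 1 1] with x h00 h01 h10 h11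
  ext i j
  fin_cases i <;> fin_cases j <;> simpa [matAt]

theorem matAt_zero {T : TriMesh} : ∀ᵐ x ∂(bodyMeasure T), matAt (0 : TenField T) x = 0 := by
  filter_upwards [matAt_smul (0 : ℝ) (0 : TenField T)] with x hx
  simpa using hx

theorem integrable_frob {T : TriMesh} (S R : TenField T) :
    Integrable (fun x => frob (matAt S x) (matAt R x)) (bodyMeasure T) :=
  integrable_finsetSum _ fun i _ => integrable_finsetSum _ fun j _ =>
    (Lp.memLp (S i j)).integrable_mul (Lp.memLp (R i j))

/-- The sum of the integrands of the form of Newton's iteration. -/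
def newtonIntegrand {T : TriMesh} (A : Mat2 → Mat2 →ₗ[ℝ] Mat2) (u z y : Quad T) (x : Pt) : ℝ :=
  frob (matAt z.stress x) (matAt y.gradDisp x)
    + frob (matAt z.gradDisp x) (matAt y.dgrad x) - frob (matAt z.dgrad x) (matAt y.dgrad x)
    + elasticIntegrand A u z y x - frob (matAt z.stress x) (matAt y.stress x)
    + pressureIntegrand u z y x - couplingIntegrand u z y x + volumeIntegrand u z y x

section Bilinear

variable {T : TriMesh} {F : FEChoice T} {Γ : Finset (Finset Pt)} {A : Mat2 → Mat2 →ₗ[ℝ] Mat2}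
  {u : Quad T}

theorem integrable_newtonIntegrand (h : F.Admissible Γ A u) {z y : Quad T} (hz : z ∈ F.Zh Γ)
    (hy : y ∈ F.Zh Γ) : Integrable (newtonIntegrand A u z y) (bodyMeasure T) :=
  (((((((integrable_frob _ _).add (integrable_frob _ _)).sub (integrable_frob _ _)).add
    (h.elastic z hz y hy)).sub (integrable_frob _ _)).add (h.pressure z hz y hy)).sub
    (h.coupling z hz y hy)).add (h.volume z hz y hy)

/-- Integrals add up only for integrable functions, which is what admissibility provides. With a
single integrand, bilinearity reduces to identities that hold almost everywhere. -/
theorem newtonForm_eq_integral (h : F.Admissible Γ A u) {z y : Quad T} (hz : z ∈ F.Zh Γ)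
    (hy : y ∈ F.Zh Γ) : newtonForm A u z y = ∫ x, newtonIntegrand A u z y x ∂(bodyMeasure T) := by
  have i1 := integrable_frob z.stress y.gradDisp
  have i2 := i1.add (integrable_frob z.gradDisp y.dgrad)
  have i3 := i2.sub (integrable_frob z.dgrad y.dgrad)
  have i4 := i3.add (h.elastic z hz y hy)
  have i5 := i4.sub (integrable_frob z.stress y.stress)
  have i6 := i5.add (h.pressure z hz y hy)
  have i7 := i6.sub (h.coupling z hz y hy)
  have e := integral_add' i7 (h.volume z hz y hy)
  rw [integral_sub' i6 (h.coupling z hz y hy), integral_add' i5 (h.pressure z hz y hy),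
    integral_sub' i4 (integrable_frob z.stress y.stress), integral_add' i3 (h.elastic z hz y hy),
    integral_sub' i2 (integrable_frob z.dgrad y.dgrad),
    integral_add' i1 (integrable_frob z.gradDisp y.dgrad)] at e
  exact e.symm

theorem newtonIntegrand_add_left (z z' y : Quad T) : ∀ᵐ x ∂(bodyMeasure T),
    newtonIntegrand A u (z + z') y x = newtonIntegrand A u z y x + newtonIntegrand A u z' y x := by
  have hp : ∀ᵐ x ∂(bodyMeasure T), (z.press + z'.press : LTwo T) x = z.press x + z'.press x :=
    Lp.coeFn_add _ _
  filter_upwards [matAt_add z.stress z'.stress, matAt_add z.dgrad z'.dgrad,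
    matAt_add z.gradDisp z'.gradDisp, hp] with x h1 h2 h3 h4
  have e1 : (z + z').stress = z.stress + z'.stress := rfl
  have e2 : (z + z').dgrad = z.dgrad + z'.dgrad := rfl
  have e3 : (z + z').gradDisp = z.gradDisp + z'.gradDisp := rfl
  have e4 : (z + z').press = z.press + z'.press := rfl
  simp only [newtonIntegrand, elasticIntegrand, pressureIntegrand, couplingIntegrand,
    volumeIntegrand, e1, e2, e3, e4, h1, h2, h3, h4, frob_add_left, map_add, Matrix.transpose_add,
    Matrix.mul_add, Matrix.add_mul, smul_add, add_smul, Matrix.trace_add]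
  ring

theorem newtonIntegrand_add_right (z y y' : Quad T) : ∀ᵐ x ∂(bodyMeasure T),
    newtonIntegrand A u z (y + y') x = newtonIntegrand A u z y x + newtonIntegrand A u z y' x := by
  have hp : ∀ᵐ x ∂(bodyMeasure T), (y.press + y'.press : LTwo T) x = y.press x + y'.press x :=
    Lp.coeFn_add _ _
  filter_upwards [matAt_add y.stress y'.stress, matAt_add y.dgrad y'.dgrad,
    matAt_add y.gradDisp y'.gradDisp, hp] with x h1 h2 h3 h4
  have e1 : (y + y').stress = y.stress + y'.stress := rfl
  have e2 : (y + y').dgrad = y.dgrad + y'.dgrad := rfl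
  have e3 : (y + y').gradDisp = y.gradDisp + y'.gradDisp := rfl
  have e4 : (y + y').press = y.press + y'.press := rfl
  simp only [newtonIntegrand, elasticIntegrand, pressureIntegrand, couplingIntegrand,
    volumeIntegrand, e1, e2, e3, e4, h1, h2, h3, h4, frob_add_right]
  ring

theorem newtonIntegrand_smul_left (c : ℝ) (z y : Quad T) : ∀ᵐ x ∂(bodyMeasure T),
    newtonIntegrand A u (c • z) y x = c * newtonIntegrand A u z y x := by
  have hp : ∀ᵐ x ∂(bodyMeasure T), (c • z.press : LTwo T) x = c * z.press x :=
    Lp.coeFn_smul _ _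
  filter_upwards [matAt_smul c z.stress, matAt_smul c z.dgrad, matAt_smul c z.gradDisp, hp]
    with x h1 h2 h3 h4
  have e1 : (c • z).stress = c • z.stress := rfl
  have e2 : (c • z).dgrad = c • z.dgrad := rfl
  have e3 : (c • z).gradDisp = c • z.gradDisp := rfl
  have e4 : (c • z).press = c • z.press := rfl
  simp only [newtonIntegrand, elasticIntegrand, pressureIntegrand, couplingIntegrand,
    volumeIntegrand, e1, e2, e3, e4, h1, h2, h3, h4, frob_smul_left, map_smul,
    Matrix.transpose_smul, Matrix.mul_smul, Matrix.smul_mul, Matrix.trace_smul, smul_eq_mul]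
  ring

theorem newtonIntegrand_smul_right (c : ℝ) (z y : Quad T) : ∀ᵐ x ∂(bodyMeasure T),
    newtonIntegrand A u z (c • y) x = c * newtonIntegrand A u z y x := by
  have hp : ∀ᵐ x ∂(bodyMeasure T), (c • y.press : LTwo T) x = c * y.press x :=
    Lp.coeFn_smul _ _
  filter_upwards [matAt_smul c y.stress, matAt_smul c y.dgrad, matAt_smul c y.gradDisp, hp]
    with x h1 h2 h3 h4
  have e1 : (c • y).stress = c • y.stress := rfl
  have e2 : (c • y).dgrad = c • y.dgrad := rfl
  have e3 : (c • y).gradDisp = c • y.gradDisp := rfl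
  have e4 : (c • y).press = c • y.press := rfl
  simp only [newtonIntegrand, elasticIntegrand, pressureIntegrand, couplingIntegrand,
    volumeIntegrand, e1, e2, e3, e4, h1, h2, h3, h4, frob_smul_right]
  ring

/-- The form of Newton's iteration as a bilinear form on the discrete space. -/
def newtonBilin (h : F.Admissible Γ A u) : F.Zh Γ →ₗ[ℝ] F.Zh Γ →ₗ[ℝ] ℝ :=
  LinearMap.mk₂ ℝ (fun z y => newtonForm A u z.1 y.1)
    (fun z z' y => by
      rw [newtonForm_eq_integral h (z + z').2 y.2, newtonForm_eq_integral h z.2 y.2,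
        newtonForm_eq_integral h z'.2 y.2, ← integral_add (integrable_newtonIntegrand h z.2 y.2)
          (integrable_newtonIntegrand h z'.2 y.2)]
      exact integral_congr_ae (newtonIntegrand_add_left _ _ _))
    (fun c z y => by
      rw [newtonForm_eq_integral h (c • z).2 y.2, newtonForm_eq_integral h z.2 y.2, smul_eq_mul,
        ← integral_const_mul]
      exact integral_congr_ae (newtonIntegrand_smul_left _ _ _))
    (fun z y y' => by
      rw [newtonForm_eq_integral h z.2 (y + y').2, newtonForm_eq_integral h z.2 y.2,
        newtonForm_eq_integral h z.2 y'.2, ← integral_add (integrable_newtonIntegrand h z.2 y.2)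
          (integrable_newtonIntegrand h z.2 y'.2)]
      exact integral_congr_ae (newtonIntegrand_add_right _ _ _))
    (fun c z y => by
      rw [newtonForm_eq_integral h z.2 (c • y).2, newtonForm_eq_integral h z.2 y.2, smul_eq_mul,
        ← integral_const_mul]
      exact integral_congr_ae (newtonIntegrand_smul_right _ _ _))

/-! ### Restricted test functions and instability -/

theorem tenInner_zero_left (S : TenField T) : tenInner 0 S = 0 := by
  rw [tenInner, integral_eq_zero_of_ae]
  filter_upwards [matAt_zero (T := T)] with x hx
  simp [hx, frob_zero_left]

theorem tenInner_zero_right (S : TenField T) : tenInner S 0 = 0 := by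
  rw [tenInner, integral_eq_zero_of_ae]
  filter_upwards [matAt_zero (T := T)] with x hx
  simp [hx, frob_zero_right]

theorem integral_elasticIntegrand_eq_zero {z y : Quad T} (h : y.stress = 0) :
    ∫ x, elasticIntegrand A u z y x ∂(bodyMeasure T) = 0 := by
  refine integral_eq_zero_of_ae ?_
  filter_upwards [matAt_zero (T := T)] with x hx
  simp [elasticIntegrand, h, hx, frob_zero_right]

theorem integral_pressureIntegrand_eq_zero {z y : Quad T} (h : y.stress = 0) :
    ∫ x, pressureIntegrand u z y x ∂(bodyMeasure T) = 0 := by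
  refine integral_eq_zero_of_ae ?_
  filter_upwards [matAt_zero (T := T)] with x hx
  simp [pressureIntegrand, h, hx, frob_zero_right]

theorem integral_couplingIntegrand_eq_zero {z y : Quad T} (h : y.stress = 0) :
    ∫ x, couplingIntegrand u z y x ∂(bodyMeasure T) = 0 := by
  refine integral_eq_zero_of_ae ?_
  filter_upwards [matAt_zero (T := T)] with x hx
  simp [couplingIntegrand, h, hx, frob_zero_right]

theorem integral_volumeIntegrand_eq_zero {z y : Quad T} (h : y.press = 0) :
    ∫ x, volumeIntegrand u z y x ∂(bodyMeasure T) = 0 := by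
  refine integral_eq_zero_of_ae ?_
  filter_upwards [Lp.coeFn_zero ℝ 2 (bodyMeasure T)] with x hx
  rw [volumeIntegrand, h, hx]
  simp

theorem integral_volumeIntegrand_eq_zero' {z y : Quad T} (h : z.dgrad = 0) :
    ∫ x, volumeIntegrand u z y x ∂(bodyMeasure T) = 0 := by
  refine integral_eq_zero_of_ae ?_
  filter_upwards [matAt_zero (T := T)] with x hx
  simp [volumeIntegrand, h, hx]

/-- Test functions whose only nonzero component is a displacement just see the stress. -/
theorem newtonForm_disp {z y : Quad T} (hz : z.stress = 0) (h1 : y.dgrad = 0) (h2 : y.stress = 0)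
    (h3 : y.press = 0) : newtonForm A u z y = 0 := by
  simp [newtonForm, hz, h1, tenInner_zero_left, tenInner_zero_right,
    integral_elasticIntegrand_eq_zero h2, integral_pressureIntegrand_eq_zero h2,
    integral_couplingIntegrand_eq_zero h2, integral_volumeIntegrand_eq_zero h3]

/-- Test functions whose only nonzero component is a pressure just see the displacement gradient. -/
theorem newtonForm_press {z y : Quad T} (hz : z.dgrad = 0) (h1 : y.gradDisp = 0) (h2 : y.dgrad = 0)
    (h3 : y.stress = 0) : newtonForm A u z y = 0 := by
  simp [newtonForm, h1, h2, h3, tenInner_zero_right,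
    integral_elasticIntegrand_eq_zero h3, integral_pressureIntegrand_eq_zero h3,
    integral_couplingIntegrand_eq_zero h3, integral_volumeIntegrand_eq_zero' hz]

/-- Test functions without displacement and stress just see the displacement and its gradient. -/
theorem newtonForm_dgrad_press {z y : Quad T} (hz : z.gradDisp = 0) (hz' : z.dgrad = 0)
    (h1 : y.gradDisp = 0) (h2 : y.stress = 0) : newtonForm A u z y = 0 := by
  simp [newtonForm, hz, hz', h1, h2, tenInner_zero_right, tenInner_zero_left,
    integral_elasticIntegrand_eq_zero h2, integral_pressureIntegrand_eq_zero h2,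
    integral_couplingIntegrand_eq_zero h2, integral_volumeIntegrand_eq_zero' hz']

instance (F : FEChoice T) (Γ : Finset (Finset Pt)) : FiniteDimensional ℝ (F.V1van Γ) :=
  have := F.fin1
  Submodule.finiteDimensional_of_le (inf_le_left : F.V1 ⊓ HOneVanishing T Γ ≤ F.V1)

instance (F : FEChoice T) : FiniteDimensional ℝ F.Vc := F.finc
instance (F : FEChoice T) : FiniteDimensional ℝ F.Vd := F.find
instance (F : FEChoice T) : FiniteDimensional ℝ F.VD := F.finD

instance (F : FEChoice T) (Γ : Finset (Finset Pt)) : FiniteDimensional ℝ (F.Zh Γ) := by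
  have hfg : ∀ {M : Type} [AddCommGroup M] [Module ℝ M] (p : Submodule ℝ M),
      FiniteDimensional ℝ p → p.FG := fun p h => Module.Finite.iff_fg.1 h
  exact Module.Finite.iff_fg.2 ((hfg (F.V1van Γ) inferInstance).prod
    ((hfg F.Vc inferInstance).prod ((hfg F.Vd inferInstance).prod (hfg F.VD inferInstance))))

/-- A left kernel of the bilinear form excludes every inf-sup constant and unique solvability. -/
theorem unstable_of_left_kernel (h : F.Admissible Γ A u) {y : F.Zh Γ} (hy : y ≠ 0)
    (hk : ∀ z, newtonBilin h z y = 0) :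
    (¬ ∃ α : ℝ, 0 < α ∧ F.InfSup Γ A u α) ∧
      ∀ ℓ : Quad T → ℝ, ¬ ∃! z : Quad T, F.SolvesNewton Γ A u ℓ z := by
  constructor
  · rintro ⟨α, hα, hinf⟩
    have h1 := hinf.trans (iInf_le _ ⟨y.1, y.2, fun e => hy (Subtype.ext e)⟩)
    have h2 : (⨆ z : {z : Quad T // z ∈ F.Zh Γ ∧ z ≠ 0},
        ((newtonForm A u z.1 y.1 / (z.1.normZ * y.1.normZ) : ℝ) : EReal)) ≤ 0 := by
      refine iSup_le fun z => ?_
      have h3 : newtonForm A u z.1 y.1 = 0 := hk ⟨z.1, z.2.1⟩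
      rw [h3]
      simp
    have h4 : (α : EReal) ≤ 0 := h1.trans h2
    exact absurd hα (not_lt.2 (by exact_mod_cast h4))
  · rintro ℓ ⟨z, ⟨hz, hsol⟩, huniq⟩
    -- If a solution exists, adding an element of the right kernel gives a second one.
    obtain ⟨w, hw, hBw⟩ := exists_right_kernel (newtonBilin h) hy hk
    have h1 : z + w.1 = z := by
      refine huniq _ ⟨Submodule.add_mem _ hz w.2, fun v hv => ?_⟩
      have h2 := LinearMap.congr_fun (map_add (newtonBilin h) ⟨z, hz⟩ w) ⟨v, hv⟩
      rw [hBw, add_zero] at h2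
      rw [← hsol v hv]
      exact h2
    exact hw (Subtype.ext (by simpa using h1))

/-- A space of test functions for which the form sees trial functions only through a projection to
a space of smaller dimension contains a left kernel. -/
theorem unstable_of_finrank_lt {Y W : Type*} [AddCommGroup Y] [Module ℝ Y] [AddCommGroup W]
    [Module ℝ W] [FiniteDimensional ℝ Y] [FiniteDimensional ℝ W] (h : F.Admissible Γ A u)
    (J : Y →ₗ[ℝ] F.Zh Γ) (hJ : Function.Injective J) (P : F.Zh Γ →ₗ[ℝ] W)
    (hP : ∀ y z, P z = 0 → newtonForm A u z.1 (J y).1 = 0)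
    (hlt : Module.finrank ℝ W < Module.finrank ℝ Y) :
    (¬ ∃ α : ℝ, 0 < α ∧ F.InfSup Γ A u α) ∧
      ∀ ℓ : Quad T → ℝ, ¬ ∃! z : Quad T, F.SolvesNewton Γ A u ℓ z := by
  obtain ⟨y, hy, hf⟩ := exists_ne_zero_of_finrank_lt ((newtonBilin h).flip ∘ₗ J) P hP hlt
  exact unstable_of_left_kernel h (y := J y) (fun e => hy (hJ (by rw [e, map_zero])))
    (fun z => LinearMap.congr_fun hf z)

/-- Test with displacements only: the one surviving term pairs their gradients with the stress of z.
-/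
theorem unstable_of_nd_lt_n1 (h : F.Admissible Γ A u) (hlt : F.n1 Γ > F.nd) :
    (¬ ∃ α : ℝ, 0 < α ∧ F.InfSup Γ A u α) ∧
      ∀ ℓ : Quad T → ℝ, ¬ ∃! z : Quad T, F.SolvesNewton Γ A u ℓ z := by
  refine unstable_of_finrank_lt (Y := F.V1van Γ) (W := F.Vd) h
    ((LinearMap.inl ℝ _ _ ∘ₗ (F.V1van Γ).subtype).codRestrict (F.Zh Γ) fun v =>
      ⟨v.2, Submodule.zero_mem _⟩)
    (fun v w e => ?_)
    ((LinearMap.fst ℝ _ _ ∘ₗ LinearMap.snd ℝ _ _ ∘ₗ LinearMap.snd ℝ _ _ ∘ₗ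
      (F.Zh Γ).subtype).codRestrict F.Vd fun z => z.2.2.2.1)
    (fun y z hz => ?_) hlt
  · exact Subtype.ext (congrArg (fun q : F.Zh Γ => q.1.1) e)
  · have h1 : z.1.2.2.1 = 0 := congrArg Subtype.val hz
    exact newtonForm_disp (congrArg Prod.fst h1) rfl rfl rfl

/-- Test with pressures only: the volume term survives, and it contains z only through M. -/
theorem unstable_of_nc_lt_nD (h : F.Admissible Γ A u) (hlt : F.nD > F.nc) :
    (¬ ∃ α : ℝ, 0 < α ∧ F.InfSup Γ A u α) ∧
      ∀ ℓ : Quad T → ℝ, ¬ ∃! z : Quad T, F.SolvesNewton Γ A u ℓ z := by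
  refine unstable_of_finrank_lt (Y := F.VD) (W := F.Vc) h
    ((LinearMap.inr ℝ _ _ ∘ₗ LinearMap.inr ℝ _ _ ∘ₗ LinearMap.inr ℝ _ _ ∘ₗ
      F.VD.subtype).codRestrict (F.Zh Γ) fun v =>
      ⟨Submodule.zero_mem _, Submodule.zero_mem _, Submodule.zero_mem _, v.2⟩)
    (fun v w e => ?_)
    ((LinearMap.fst ℝ _ _ ∘ₗ LinearMap.snd ℝ _ _ ∘ₗ
      (F.Zh Γ).subtype).codRestrict F.Vc fun z => z.2.2.1)
    (fun y z hz => ?_) hlt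
  · exact Subtype.ext (congrArg (fun q : F.Zh Γ => q.1.2.2.2) e)
  · have h1 : z.1.2.1 = 0 := congrArg Subtype.val hz
    exact newtonForm_press (congrArg Prod.fst h1) rfl rfl rfl

/-- Test with pairs (λ, q): the surviving terms contain z through grad V and M. Admitting λ adds n_c
to the test side and so compensates for M on the trial side. -/
theorem unstable_of_n1_lt_nD (h : F.Admissible Γ A u) (hlt : F.nD > F.n1 Γ) :
    (¬ ∃ α : ℝ, 0 < α ∧ F.InfSup Γ A u α) ∧
      ∀ ℓ : Quad T → ℝ, ¬ ∃! z : Quad T, F.SolvesNewton Γ A u ℓ z := by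
  refine unstable_of_finrank_lt (Y := F.Vc × F.VD) (W := F.V1van Γ × F.Vc) h
    ((LinearMap.inr ℝ _ _ ∘ₗ LinearMap.prodMap F.Vc.subtype
      (LinearMap.inr ℝ _ _ ∘ₗ F.VD.subtype)).codRestrict (F.Zh Γ) fun v =>
      ⟨Submodule.zero_mem _, v.1.2, Submodule.zero_mem _, v.2.2⟩)
    (fun v w e => ?_)
    (((LinearMap.fst ℝ _ _ ∘ₗ (F.Zh Γ).subtype).codRestrict (F.V1van Γ) fun z => z.2.1).prod
      ((LinearMap.fst ℝ _ _ ∘ₗ LinearMap.snd ℝ _ _ ∘ₗ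
        (F.Zh Γ).subtype).codRestrict F.Vc fun z => z.2.2.1))
    (fun y z hz => ?_) ?_
  · exact Prod.ext (Subtype.ext (congrArg (fun q : F.Zh Γ => q.1.2.1) e))
      (Subtype.ext (congrArg (fun q : F.Zh Γ => q.1.2.2.2) e))
  · have h1 : z.1.1 = 0 := congrArg (fun p => (Prod.fst p).1) hz
    have h2 : z.1.2.1 = 0 := congrArg (fun p => (Prod.snd p).1) hz
    exact newtonForm_dgrad_press (congrArg Prod.snd h1) (congrArg Prod.fst h2) rfl rfl
  · rw [Module.finrank_prod, Module.finrank_prod]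
    change F.n1 Γ + F.nc < F.nc + F.nD
    omega

end Bilinear

/-! Dimensions of finite element spaces. -/

/-- Evaluation of polynomials at a point as a linear map. -/
def evalLin (x : Pt) : Poly2 →ₗ[ℝ] ℝ where
  toFun := evalAt x
  map_add' := map_add _
  map_smul' c q := evalAt_smul x c q

@[simp] theorem evalLin_apply (x : Pt) (q : Poly2) : evalLin x q = evalAt x q := rfl

theorem IsPiecewise.eq_zero {T : TriMesh} {f : LTwo T} {w : Finset Pt → Poly2}
    (h : IsPiecewise T f w) (hw : ∀ K ∈ T.cells, w K = 0) : f = 0 := by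
  refine IsPiecewise.unique_left (w := fun _ => 0) (fun K hK => ?_) (IsPiecewise.zero T)
  rw [← hw K hK]
  exact h K hK

/-- Monomials form a basis. Their exponents are listed as pairs of numbers so that `decide` can
count them for m = 1 and m = 2; a lower bound is all that is needed. -/
theorem card_le_finrank_restrictTotalDegree (m : ℕ) :
    (((Finset.range (m + 1)) ×ˢ (Finset.range (m + 1))).filter fun p : ℕ × ℕ => p.1 + p.2 ≤ m).card ≤
      Module.finrank ℝ (MvPolynomial.restrictTotalDegree (Fin 2) ℝ m) := by
  set S := ((Finset.range (m + 1)) ×ˢ (Finset.range (m + 1))).filter fun p : ℕ × ℕ => p.1 + p.2 ≤ m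
  have b : Module.Basis {n : Fin 2 →₀ ℕ | (n.sum fun _ e => e) ≤ m} ℝ
      (MvPolynomial.restrictTotalDegree (Fin 2) ℝ m) := MvPolynomial.basisRestrictSupport ℝ _
  have : Finite {n : Fin 2 →₀ ℕ | (n.sum fun _ e => e) ≤ m} := Module.Finite.finite_basis b
  have hS : ∀ p : ℕ × ℕ, p ∈ S → p.1 + p.2 ≤ m := fun p hp => (Finset.mem_filter.1 hp).2
  have h1 : Module.finrank ℝ (MvPolynomial.restrictTotalDegree (Fin 2) ℝ m) =
    Nat.card {n : Fin 2 →₀ ℕ | (n.sum fun _ e => e) ≤ m} := Module.finrank_eq_nat_card_basis b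
  rw [h1, ← Nat.card_eq_finsetCard S]
  refine Nat.card_le_card_of_injective
    (fun p => ⟨Finsupp.equivFunOnFinite.symm ![p.1.1, p.1.2], ?_⟩) ?_
  · have hp := hS p.1 p.2
    simp only [Set.mem_ofPred_eq]
    rw [Finsupp.sum_fintype _ _ (fun _ => rfl), Fin.sum_univ_two]
    simpa using hp
  · intro p p' h
    have h2 := congrArg (fun n => (n : Fin 2 →₀ ℕ)) (Subtype.ext_iff.1 h)
    have e0 := DFunLike.congr_fun h2 0
    have e1 := DFunLike.congr_fun h2 1
    exact Subtype.ext (Prod.ext (by simpa using e0) (by simpa using e1))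

/-- The polynomials on the elements can be chosen independently. Finite dimension has to be assumed,
as `finrank` is zero by default otherwise. -/
theorem card_mul_finrank_le_finrank_elemD (T : TriMesh) (k : ℕ) [FiniteDimensional ℝ (elemD T k)] :
    T.cells.card * Module.finrank ℝ (MvPolynomial.restrictTotalDegree (Fin 2) ℝ k) ≤
      Module.finrank ℝ (elemD T k) := by
  let ι : (T.cells → MvPolynomial.restrictTotalDegree (Fin 2) ℝ k) →ₗ[ℝ] (T.cells → Poly2) :=
    LinearMap.pi fun K => Submodule.subtype _ ∘ₗ LinearMap.proj K
  have hι : Function.Injective ι := fun v w h => by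
    ext1 K
    exact Subtype.ext (congrFun h K)
  let J := ((assemble T ∘ₗ extendCells T) ∘ₗ ι).codRestrict (elemD T k) fun w =>
    ⟨extendCells T (ι w), fun K hK => by
      rw [extendCells_apply T (ι w) ⟨K, hK⟩]
      exact (w ⟨K, hK⟩).2, assemble_spec T _⟩
  have hJ : Function.Injective J := fun v w h =>
    hι (assemble_extendCells_injective T (congrArg Subtype.val h))
  have := LinearMap.finrank_le_finrank_of_injective hJ
  rw [Module.finrank_pi_fintype] at this
  simpa using this

theorem three_mul_card_le_nD {T : TriMesh} (F : FEChoice T) (h : F.VD = elemD T 1) :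
    3 * T.cells.card ≤ F.nD := by
  have hfin := F.finD
  rw [FEChoice.nD]
  rw [h] at hfin ⊢
  have h1 := card_mul_finrank_le_finrank_elemD T 1
  have h2 := card_le_finrank_restrictTotalDegree 1
  have h3 : (((Finset.range (1 + 1)) ×ˢ (Finset.range (1 + 1))).filter
    fun p : ℕ × ℕ => p.1 + p.2 ≤ 1).card = 3 := by decide
  nlinarith

theorem six_mul_card_le_nD {T : TriMesh} (F : FEChoice T) (h : F.VD = elemD T 2) :
    6 * T.cells.card ≤ F.nD := by
  have hfin := F.finD
  rw [FEChoice.nD]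
  rw [h] at hfin ⊢
  have h1 := card_mul_finrank_le_finrank_elemD T 2
  have h2 := card_le_finrank_restrictTotalDegree 2
  have h3 : (((Finset.range (2 + 1)) ×ˢ (Finset.range (2 + 1))).filter
    fun p : ℕ × ℕ => p.1 + p.2 ≤ 2).card = 6 := by decide
  nlinarith

/-! ### Edge elements -/

theorem evalAt_nedelecShape {w : Fin 2 → Poly2} (hw : w ∈ nedelecShape) :
    ∃ α β γ : ℝ, w = ![MvPolynomial.C α - MvPolynomial.C γ * MvPolynomial.X 1,
      MvPolynomial.C β + MvPolynomial.C γ * MvPolynomial.X 0] := by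
  rw [nedelecShape, Submodule.mem_span_triple] at hw
  obtain ⟨α, β, γ, rfl⟩ := hw
  refine ⟨α, β, γ, ?_⟩
  ext1 j
  fin_cases j <;> simp [MvPolynomial.smul_eq_C_mul, sub_eq_add_neg]

/-- The vertices of a nondegenerate triangle span a nonzero area. -/
theorem IsTriangle.det_ne_zero {a b c : Pt} (hab : a ≠ b) (hac : a ≠ c) (hbc : b ≠ c)
    (h : IsTriangle {a, b, c}) :
    (b 0 - a 0) * (c 1 - a 1) - (b 1 - a 1) * (c 0 - a 0) ≠ 0 := by
  intro hD
  -- Every point is an affine combination of the vertices; without area it would satisfy the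
  -- equation of the line through a and b.
  have key : ∀ x : Pt, (b 0 - a 0) * (x 1 - a 1) - (b 1 - a 1) * (x 0 - a 0) = 0 := by
    intro x
    have h1 := h.sum_bary x
    have h2 := h.sum_bary_smul x
    have hna : a ∉ ({b, c} : Finset Pt) := by simp [hab, hac]
    have hnb : b ∉ ({c} : Finset Pt) := by simp [hbc]
    rw [Finset.sum_insert hna, Finset.sum_insert hnb, Finset.sum_singleton] at h1 h2
    have e0 : _ * a 0 + (_ * b 0 + _ * c 0) = x 0 := congrArg (fun y : Pt => y 0) h2
    have e1 : _ * a 1 + (_ * b 1 + _ * c 1) = x 1 := congrArg (fun y : Pt => y 1) h2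
    linear_combination (bary {a, b, c} c x) * hD - (b 0 - a 0) * e1 + (b 1 - a 1) * e0
      + ((b 0 - a 0) * a 1 - (b 1 - a 1) * a 0) * h1
  -- The translates of a by the two unit vectors show that both components of b - a vanish.
  have h0 := key (!₂[a 0, a 1 + 1])
  have h1 := key (!₂[a 0 + 1, a 1])
  simp at h0 h1
  apply hab
  ext j
  fin_cases j
  · simp; linarith
  · simp; linarith

/-- A Nédélec shape function is determined by its tangential components along the edges. -/
theorem nedelecShape_eq_zero {K : Finset Pt} (hK : IsTriangle K) {w : Fin 2 → Poly2}
    (hw : w ∈ nedelecShape)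
    (h : ∀ a ∈ K, ∀ b ∈ K, a ≠ b → ∃ x, (x = a ∨ x = b) ∧
      evalAt x (w 0) * (b 0 - a 0) + evalAt x (w 1) * (b 1 - a 1) = 0) : w = 0 := by
  obtain ⟨α, β, γ, rfl⟩ := evalAt_nedelecShape hw
  obtain ⟨a, b, c, hab, hac, hbc, rfl⟩ := Finset.card_eq_three.1 hK.card_eq
  have hD := hK.det_ne_zero hab hac hbc
  -- The tangential component of a shape function is constant along an edge, so both end points give
  -- the same equation.
  have key : ∀ a' ∈ ({a, b, c} : Finset Pt), ∀ b' ∈ ({a, b, c} : Finset Pt), a' ≠ b' →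
      α * (b' 0 - a' 0) + β * (b' 1 - a' 1) + γ * (a' 0 * b' 1 - a' 1 * b' 0) = 0 := by
    intro a' ha b' hb hne
    obtain ⟨x, hx, he⟩ := h a' ha b' hb hne
    simp only [Matrix.cons_val_zero, Matrix.cons_val_one, evalAt, map_sub, map_add, map_mul,
      MvPolynomial.eval_C, MvPolynomial.eval_X] at he
    rcases hx with rfl | rfl <;> linear_combination he
  have k1 := key a (by simp) b (by simp) hab
  have k2 := key b (by simp) c (by simp) hbc
  have k3 := key c (by simp) a (by simp) hac.symm
  -- Summation around the triangle cancels α and β and leaves γ times twice the signed area.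
  have hγ : γ = 0 := by
    have : γ * ((b 0 - a 0) * (c 1 - a 1) - (b 1 - a 1) * (c 0 - a 0)) = 0 := by
      linear_combination k1 + k2 + k3
    exact (mul_eq_zero.1 this).resolve_right hD
  subst hγ
  -- The field is now constant and orthogonal to two independent edges.
  have hα : α = 0 := by
    have : α * ((b 0 - a 0) * (c 1 - a 1) - (b 1 - a 1) * (c 0 - a 0)) = 0 := by
      linear_combination (c 1 - a 1) * k1 + (b 1 - a 1) * k3
    exact (mul_eq_zero.1 this).resolve_right hD
  have hβ : β = 0 := by
    have : β * ((b 0 - a 0) * (c 1 - a 1) - (b 1 - a 1) * (c 0 - a 0)) = 0 := by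
      linear_combination -(c 0 - a 0) * k1 - (b 0 - a 0) * k3
    exact (mul_eq_zero.1 this).resolve_right hD
  subst hα hβ
  ext1 j
  fin_cases j <;> simp

theorem TriMesh.exists_edge_data (T : TriMesh) (e : T.edgeFinset) :
    ∃ p q : Pt, ∃ K ∈ T.cells, p ≠ q ∧ e.1 = {p, q} ∧ e.1 ⊆ K := by
  obtain ⟨h2, K, hK, heK⟩ := TriMesh.mem_edgeFinset.1 e.2
  obtain ⟨p, q, hpq, he⟩ := Finset.card_eq_two.1 h2
  exact ⟨p, q, K, hK, hpq, he, heK⟩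

/-- The degrees of freedom are one tangential value per edge and row, read off at the end point `p
e` from the chosen element `L e`; tangential continuity carries it to the other elements on that
edge. Finite dimension is part of the conclusion because `finrank_elemR1_le` embeds into this space.
-/
theorem finrank_elemN11 (T : TriMesh) :
    FiniteDimensional ℝ (elemN11 T) ∧ Module.finrank ℝ (elemN11 T) ≤ 2 * T.edgeFinset.card := by
  choose p q L hL hpq he heL using T.exists_edge_data
  let μ : RowPair T →ₗ[ℝ] (Fin 2 × T.edgeFinset → ℝ) := LinearMap.pi fun ie =>
    ((q ie.2 0 - p ie.2 0) • (evalLin (p ie.2) ∘ₗ piece T (L ie.2) ∘ₗ LinearMap.proj 0 ∘ₗ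
      LinearMap.proj ie.1 ∘ₗ LinearMap.fst ℝ _ _) +
    (q ie.2 1 - p ie.2 1) • (evalLin (p ie.2) ∘ₗ piece T (L ie.2) ∘ₗ LinearMap.proj 1 ∘ₗ
      LinearMap.proj ie.1 ∘ₗ LinearMap.fst ℝ _ _))
  have hμ : ∀ u i e, μ u (i, e) =
      (q e 0 - p e 0) * evalAt (p e) (piece T (L e) (u.1 i 0)) +
      (q e 1 - p e 1) * evalAt (p e) (piece T (L e) (u.1 i 1)) := fun _ _ _ => rfl
  have hinj : Function.Injective (μ ∘ₗ (elemN11 T).subtype) := by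
    rw [← LinearMap.ker_eq_bot, LinearMap.ker_eq_bot']
    rintro ⟨u, hu⟩ h0
    have h0 : ∀ i e, μ u (i, e) = 0 := fun i e => congrFun h0 (i, e)
    have hrow : ∀ i, (∀ j, u.1 i j = 0) ∧ u.2 i = 0 := by
      intro i
      obtain ⟨w, hw, hc, hp, hd⟩ := hu i
      have hwz : ∀ K ∈ T.cells, w K = 0 := by
        intro K hK
        refine nedelecShape_eq_zero (T.isTriangle hK) (hw K hK) fun a ha b hb hab => ?_
        have hmem : ({a, b} : Finset Pt) ∈ T.edgeFinset :=
          TriMesh.mem_edgeFinset.2 ⟨Finset.card_pair hab, K, hK, by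
            intro x hx
            rcases Finset.mem_insert.1 hx with rfl | hx
            · exact ha
            · rwa [Finset.mem_singleton.1 hx]⟩
        obtain ⟨e, hee⟩ : ∃ e : T.edgeFinset, e.1 = {a, b} := ⟨⟨_, hmem⟩, rfl⟩
        have haL : a ∈ L e := heL e (by rw [hee]; simp)
        have hbL : b ∈ L e := heL e (by rw [hee]; simp)
        have hpm : p e = a ∨ p e = b := by
          have : p e ∈ e.1 := by rw [he e]; simp
          simpa [hee] using this
        have hqm : q e = a ∨ q e = b := by
          have : q e ∈ e.1 := by rw [he e]; simp
          simpa [hee] using this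
        have h1 := h0 i e
        rw [hμ, (hp 0).piece_eq (hL e), (hp 1).piece_eq (hL e)] at h1
        refine ⟨p e, hpm, ?_⟩
        have hseg : p e ∈ segment ℝ a b := by
          rcases hpm with h | h <;> rw [h]
          · exact left_mem_segment ℝ a b
          · exact right_mem_segment ℝ a b
        rw [hc K hK (L e) (hL e) a b ha haL hb hbL _ hseg]
        -- The chosen order of the end points may be the reverse of (a, b), which only changes the
        -- sign.
        rcases hpm with h | h <;> rcases hqm with h' | h'
        · exact absurd (h.trans h'.symm) (hpq e)
        · rw [h, h'] at h1
          rw [h]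
          linear_combination h1
        · rw [h, h'] at h1
          rw [h]
          linear_combination -h1
        · exact absurd (h.trans h'.symm) (hpq e)
      refine ⟨fun j => (hp j).eq_zero fun K hK => by rw [hwz K hK]; rfl,
        hd.eq_zero fun K hK => by simp [hwz K hK]⟩
    refine Subtype.ext (Prod.ext ?_ ?_)
    · ext1 i; ext1 j; exact (hrow i).1 j
    · ext1 i; exact (hrow i).2
  refine ⟨FiniteDimensional.of_injective _ hinj, ?_⟩
  have := LinearMap.finrank_le_finrank_of_injective hinj
  rw [Module.finrank_fintype_fun_eq_card] at this
  simpa using this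

/-- The rotation of the rows of a tensor field by a right angle. -/
def rotateRows (T : TriMesh) : RowPair T →ₗ[ℝ] RowPair T :=
  (LinearMap.pi fun i => LinearMap.pi
    ![-(LinearMap.proj 1 ∘ₗ LinearMap.proj i ∘ₗ LinearMap.fst ℝ (TenField T) (VecField T)),
      LinearMap.proj 0 ∘ₗ LinearMap.proj i ∘ₗ LinearMap.fst ℝ (TenField T) (VecField T)]).prod
    (LinearMap.snd ℝ (TenField T) (VecField T))

theorem rotateRows_injective (T : TriMesh) : Function.Injective (rotateRows T) := by
  intro u v h
  have h2 : (rotateRows T u).2 = (rotateRows T v).2 := by rw [h]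
  have h1 : ∀ i j, (rotateRows T u).1 i j = (rotateRows T v).1 i j := by simp [h]
  refine Prod.ext ?_ h2
  ext1 i; ext1 j
  fin_cases j
  · exact h1 i 1
  · exact neg_injective (h1 i 0)

/-- A rotation by a right angle turns normal into tangential components and the divergence into the
curl. -/
theorem rotateRows_mem {T : TriMesh} {u : RowPair T} (hu : u ∈ elemR1 T) :
    rotateRows T u ∈ elemN11 T := by
  intro i
  obtain ⟨w, hw, hc, hp, hd⟩ := hu i
  refine ⟨fun K => ![-w K 1, w K 0], fun K hK => ?_, ?_, ?_, ?_⟩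
  · have h1 := hw K hK
    rw [raviartThomasShape, Submodule.mem_span_triple] at h1
    rw [nedelecShape, Submodule.mem_span_triple]
    obtain ⟨α, β, γ, h1⟩ := h1
    refine ⟨-β, α, γ, ?_⟩
    beta_reduce
    rw [← h1]
    ext1 j
    fin_cases j <;> simp [add_comm]
  · intro K hK K' hK' a b h1 h2 h3 h4 x hx
    have := hc K hK K' hK' a b h1 h2 h3 h4 x hx
    simp only [Matrix.cons_val_zero, Matrix.cons_val_one, map_neg]
    linear_combination this
  · intro j
    fin_cases j
    · have h1 := (hp 1).smul (-1)
      simp only [neg_smul, one_smul] at h1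
      exact h1
    · exact hp 0
  · intro K hK
    filter_upwards [hd K hK] with x hx hxK
    have := hx hxK
    simp only [Matrix.cons_val_zero, Matrix.cons_val_one, map_neg, sub_neg_eq_add]
    exact this

theorem finrank_elemR1_le (T : TriMesh) :
    Module.finrank ℝ (elemR1 T) ≤ 2 * T.edgeFinset.card := by
  have := (finrank_elemN11 T).1
  refine le_trans ?_ (finrank_elemN11 T).2
  refine LinearMap.finrank_le_finrank_of_injective
    (f := (rotateRows T ∘ₗ (elemR1 T).subtype).codRestrict (elemN11 T) fun u => rotateRows_mem u.2)
    fun u v h => ?_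
  exact Subtype.ext (rotateRows_injective T (congrArg Subtype.val h))

/-! Green's formula for continuous piecewise polynomials. -/

/-- A continuous function is Lipschitz if it is Lipschitz on the members of a finite closed cover. -/
theorem lipschitzWith_of_finite_closed_cover {E ι : Type*} [NormedAddCommGroup E] [NormedSpace ℝ E]
    [Finite ι] {f : E → ℝ} {C : NNReal} (hf : Continuous f) {A : ι → Set E}
    (hA : ∀ i, IsClosed (A i)) (hcov : ∀ x, ∃ i, x ∈ A i) (hL : ∀ i, LipschitzOnWith C f (A i)) :
    LipschitzWith C f := by
  refine LipschitzWith.of_dist_le_mul fun x y => ?_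
  set γ : ℝ → E := fun t => y + t • (x - y) with hγ
  have hγc : Continuous γ := by fun_prop
  set M : ℝ := C * dist x y with hM
  have hdist : ∀ s t, dist (γ s) (γ t) = |s - t| * dist x y := fun s t => by
    simp only [hγ, dist_eq_norm]
    rw [add_sub_add_left_eq_sub, ← sub_smul, norm_smul, Real.norm_eq_abs]
  refine le_of_forall_pos_le_add fun ε hε => ?_
  -- A mean value inequality along the segment from y to x that asks only for right slopes at
  -- parameters arbitrarily close to t. The slack ε makes the comparison of derivatives strict.
  have key := image_norm_le_of_liminf_right_slope_norm_lt_deriv_boundary (a := 0) (b := 1)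
    (f := fun t => f (γ t) - f (γ 0)) (f' := fun _ => M)
    ((hf.comp hγc).sub continuous_const).continuousOn ?_ (B := fun t => (M + ε) * t)
    (B' := fun _ => M + ε) (by simp) (by fun_prop)
    (fun t _ => by simpa using ((hasDerivAt_id t).const_mul (M + ε)).hasDerivWithinAt)
    (fun _ _ _ => by linarith) (x := 1) (by simp)
  · have h1 : γ 1 = x := by simp [hγ]
    have h0 : γ 0 = y := by simp [hγ]
    simpa [h1, h0, Real.dist_eq] using key
  · intro t _ r hr
    -- One of the finitely many sets is met for parameters arbitrarily close to t on the right;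
    -- being closed, it also contains the point at t.
    obtain ⟨i, hi⟩ : ∃ i, ∃ᶠ z in nhdsWithin t (Set.Ioi t), γ z ∈ A i := by
      by_contra! hcon
      have hall : ∀ᶠ z in nhdsWithin t (Set.Ioi t), ∀ i, γ z ∉ A i :=
        Filter.eventually_all.2 hcon
      obtain ⟨z, hz⟩ := hall.exists
      obtain ⟨i, hi⟩ := hcov (γ z)
      exact hz i hi
    have hti : γ t ∈ A i :=
      ((hA i).preimage hγc).mem_of_frequently_of_tendsto hi
        (Filter.tendsto_id'.2 nhdsWithin_le_nhds)
    refine (hi.and_eventually self_mem_nhdsWithin).mono fun z hz => ?_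
    have hzt : 0 < z - t := sub_pos.2 hz.2
    refine lt_of_le_of_lt ?_ hr
    rw [slope_def_field, div_le_iff₀ hzt]
    have h1 := (hL i).dist_le_mul _ hz.1 _ hti
    rw [hdist, abs_of_pos hzt, Real.dist_eq] at h1
    have h2 := abs_sub_abs_le_abs_sub (f (γ z) - f (γ 0)) (f (γ t) - f (γ 0))
    rw [sub_sub_sub_cancel_right] at h2
    simp only [Function.comp_apply, Real.norm_eq_abs]
    calc _ ≤ _ := h2
      _ ≤ _ := h1
      _ = _ := by rw [hM]; ring

/-- A compactly supported Lipschitz function has derivatives of integral zero. -/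
theorem integral_lineDeriv_eq_zero {g : Pt → ℝ} {C : NNReal} (hg : LipschitzWith C g)
    (hc : HasCompactSupport g) (v : Pt) : ∫ x, lineDeriv ℝ g x v = 0 := by
  -- Integration by parts against the constant 1; the formula reverses the direction, hence -v.
  have h := LipschitzWith.integral_lineDeriv_mul_eq (μ := (volume : Measure Pt))
    (LipschitzWith.const (1 : ℝ)) hg hc (-v)
  simpa [lineDeriv] using h.symm

section Glue

variable {T : TriMesh} {w : Finset Pt → Poly2} {φ : Pt → ℝ}

open Classical in
/-- The product of a piecewise polynomial with a function, extended by zero. -/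
def glue (T : TriMesh) (w : Finset Pt → Poly2) (φ : Pt → ℝ) (x : Pt) : ℝ :=
  if h : ∃ K ∈ T.cells, x ∈ convexHull ℝ (K : Set Pt) then evalAt x (w h.choose) * φ x else 0

theorem glue_of_notMem {x : Pt} (hx : x ∉ T.closedBody) : glue T w φ x = 0 := by
  rw [TriMesh.mem_closedBody] at hx
  rw [glue, dif_neg hx]

/-- Agreement of the polynomials of a family wherever two elements meet. -/
def IsContinuousFamily (T : TriMesh) (w : Finset Pt → Poly2) : Prop :=
  ∀ K ∈ T.cells, ∀ K' ∈ T.cells, ∀ x ∈ convexHull ℝ (K : Set Pt) ∩ convexHull ℝ (K' : Set Pt),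
    evalAt x (w K) = evalAt x (w K')

theorem glue_of_mem (hw : IsContinuousFamily T w) {K : Finset Pt} (hK : K ∈ T.cells) {x : Pt}
    (hx : x ∈ convexHull ℝ (K : Set Pt)) : glue T w φ x = evalAt x (w K) * φ x := by
  have h : ∃ K ∈ T.cells, x ∈ convexHull ℝ (K : Set Pt) := ⟨K, hK, hx⟩
  rw [glue, dif_pos h, hw _ h.choose_spec.1 K hK x ⟨h.choose_spec.2, hx⟩]

/-- A point of the closed body at which the exterior accumulates is a boundary point of the body,
where the product vanishes by assumption. -/
theorem glue_eq_zero_of_mem_closure (hw : IsContinuousFamily T w)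
    (hz : ∀ K ∈ T.cells, ∀ x ∈ convexHull ℝ (K : Set Pt), x ∈ frontier T.body →
      evalAt x (w K) * φ x = 0) {x : Pt} (hx : x ∈ closure T.closedBodyᶜ) : glue T w φ x = 0 := by
  by_cases hxU : x ∈ T.closedBody
  · obtain ⟨K, hK, hxK⟩ := TriMesh.mem_closedBody.1 hxU
    rw [glue_of_mem hw hK hxK]
    refine hz K hK x hxK ?_
    rw [T.frontier_body]
    rw [closure_compl] at hx
    exact ⟨hxU, hx⟩
  · exact glue_of_notMem hxU

theorem contDiff_evalAt_mul (hφ : ContDiff ℝ ∞ φ) (q : Poly2) :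
    ContDiff ℝ ∞ fun x => evalAt x q * φ x := (contDiff_evalAt q).mul hφ

/-- The cover of the plane by the elements and the closure of the exterior. -/
def coverSet (T : TriMesh) : Option T.cells → Set Pt
  | none => closure T.closedBodyᶜ
  | some K => convexHull ℝ (K.1 : Set Pt)

theorem isClosed_coverSet (T : TriMesh) : ∀ i, IsClosed (coverSet T i)
  | none => isClosed_closure
  | some K => isClosed_hull K.1

theorem exists_mem_coverSet (T : TriMesh) (x : Pt) : ∃ i, x ∈ coverSet T i := by
  by_cases hx : x ∈ T.closedBody
  · obtain ⟨K, hK, hxK⟩ := TriMesh.mem_closedBody.1 hx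
    exact ⟨some ⟨K, hK⟩, hxK⟩
  · exact ⟨none, subset_closure hx⟩

/-- The function is smooth on each compact element and zero on the closure of the exterior. These
finitely many closed sets cover the plane, so the Lipschitz bounds on them combine. -/
theorem exists_lipschitzWith_glue (hw : IsContinuousFamily T w) (hφ : ContDiff ℝ ∞ φ)
    (hz : ∀ K ∈ T.cells, ∀ x ∈ convexHull ℝ (K : Set Pt), x ∈ frontier T.body →
      evalAt x (w K) * φ x = 0) : ∃ C, LipschitzWith C (glue T w φ) := by
  have hlip : ∀ i, ∃ C, LipschitzOnWith C (glue T w φ) (coverSet T i) := by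
    rintro (_ | ⟨K, hK⟩)
    · refine ⟨0, fun x hx y hy => ?_⟩
      rw [glue_eq_zero_of_mem_closure hw hz hx, glue_eq_zero_of_mem_closure hw hz hy]
      simp
    · have h1 : LocallyLipschitz fun x => evalAt x (w K) * φ x :=
        ((contDiff_evalAt_mul hφ (w K)).of_le (by simp)).locallyLipschitz
      obtain ⟨C, hC⟩ := h1.locallyLipschitzOn.exists_lipschitzOnWith_of_compact (isCompact_hull K)
      refine ⟨C, fun x hx y hy => ?_⟩
      rw [glue_of_mem hw hK hx, glue_of_mem hw hK hy]
      exact hC hx hy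
  choose C hC using hlip
  have hcont : Continuous (glue T w φ) := by
    refine (locallyFinite_of_finite (coverSet T)).continuous ?_ (isClosed_coverSet T)
      fun i => (hC i).continuousOn
    exact Set.eq_univ_of_forall fun x => Set.mem_iUnion.2 (exists_mem_coverSet T x)
  refine ⟨∑ i, C i, lipschitzWith_of_finite_closed_cover hcont (isClosed_coverSet T)
    (exists_mem_coverSet T) fun i => (hC i).weaken ?_⟩
  exact Finset.single_le_sum (f := C) (fun _ _ => zero_le) (Finset.mem_univ i)

theorem hasCompactSupport_glue (T : TriMesh) (w : Finset Pt → Poly2) (φ : Pt → ℝ) :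
    HasCompactSupport (glue T w φ) :=
  HasCompactSupport.intro T.isCompact_closedBody fun _ hx => glue_of_notMem hx

theorem lineDeriv_evalAt_mul (hφ : ContDiff ℝ ∞ φ) (q : Poly2) (j : Fin 2) (x : Pt) :
    lineDeriv ℝ (fun x => evalAt x q * φ x) x (EuclideanSpace.single j 1) =
      evalAt x q * partialD j φ x + evalAt x (MvPolynomial.pderiv j q) * φ x := by
  have h1 : DifferentiableAt ℝ (fun x : Pt => evalAt x q) x :=
    (contDiff_evalAt q).differentiable (by simp) x
  have h2 : DifferentiableAt ℝ φ x := hφ.differentiable (by simp) x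
  rw [← partialD_evalAt, (h1.fun_mul h2).lineDeriv_eq_fderiv, fderiv_fun_mul h1 h2]
  simp only [partialD, add_apply, smul_apply, smul_eq_mul]
  ring

/-- Green's formula for a continuous piecewise polynomial and a test function whose product vanishes
on the boundary. -/
theorem green_of_vanishing (hw : IsContinuousFamily T w) (hφ : ContDiff ℝ ∞ φ)
    (h2 : MemLp φ 2 (bodyMeasure T)) {j : Fin 2} (h2' : MemLp (partialD j φ) 2 (bodyMeasure T))
    (hz : ∀ K ∈ T.cells, ∀ x ∈ convexHull ℝ (K : Set Pt), x ∈ frontier T.body →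
      evalAt x (w K) * φ x = 0) {f f' : LTwo T} (hf : IsPiecewise T f w)
    (hf' : IsPiecewise T f' fun K => MvPolynomial.pderiv j (w K)) :
    pairing T f (partialD j φ) = - pairing T f' φ := by
  obtain ⟨C, hC⟩ := exists_lipschitzWith_glue hw hφ hz
  have h0 := integral_lineDeriv_eq_zero hC (hasCompactSupport_glue T w φ)
    (EuclideanSpace.single j 1)
  -- Outside the closed body the glued function is locally zero, and the points of the closed body
  -- outside the body form a null set.
  have hbody : ∫ x, lineDeriv ℝ (glue T w φ) x (EuclideanSpace.single j 1) ∂(bodyMeasure T) = 0 := by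
    rw [← h0]
    refine setIntegral_eq_integral_of_ae_compl_eq_zero ?_
    filter_upwards [T.ae_mem_interior] with x hx hxb
    have hxU : x ∉ T.closedBody := fun h => by
      obtain ⟨K, hK, hxK⟩ := TriMesh.mem_closedBody.1 h
      exact hxb (T.interior_subset_body hK (hx K hK hxK))
    have hev : glue T w φ =ᶠ[nhds x] fun _ => 0 := by
      filter_upwards [T.isCompact_closedBody.isClosed.isOpen_compl.mem_nhds hxU] with y hy
      exact glue_of_notMem hy
    rw [hev.lineDeriv_eq]
    simp [lineDeriv]
  have i1 : Integrable (fun x => f x * partialD j φ x) (bodyMeasure T) :=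
    (Lp.memLp f).integrable_mul h2'
  have i2 : Integrable (fun x => f' x * φ x) (bodyMeasure T) := (Lp.memLp f').integrable_mul h2
  have hsum : pairing T f (partialD j φ) + pairing T f' φ = 0 := by
    rw [pairing, pairing, ← integral_add i1 i2, ← hbody]
    refine integral_congr_ae ?_
    filter_upwards [ae_mem_cell T, (Filter.eventually_all_finset T.cells).2 hf,
      (Filter.eventually_all_finset T.cells).2 hf'] with x ⟨K, hK, hx⟩ hfx hfx'
    have hev : glue T w φ =ᶠ[nhds x] fun x => evalAt x (w K) * φ x := by
      filter_upwards [isOpen_interior.mem_nhds hx] with y hy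
      exact glue_of_mem hw hK (interior_subset hy)
    rw [hev.lineDeriv_eq, lineDeriv_evalAt_mul hφ, hfx K hK (interior_subset hx),
      hfx' K hK (interior_subset hx)]
  linarith

end Glue

/-! Vanishing traces on boundary edges. -/

/-- A radial bump function on a disc. -/
def radialBump (p : Pt) (ρ : ℝ) (x : Pt) : ℝ := expNegInvGlue (ρ ^ 2 - ‖x - p‖ ^ 2)

theorem contDiff_radialBump (p : Pt) (ρ : ℝ) : ContDiff ℝ ∞ (radialBump p ρ) :=
  expNegInvGlue.contDiff.comp (contDiff_const.sub ((contDiff_id.sub contDiff_const).norm_sq ℝ))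

theorem radialBump_eq_zero {p : Pt} {ρ : ℝ} (hρ : 0 ≤ ρ) {x : Pt} (hx : x ∉ Metric.ball p ρ) :
    radialBump p ρ x = 0 := by
  apply expNegInvGlue.zero_of_nonpos
  rw [Metric.mem_ball, not_lt, dist_eq_norm] at hx
  nlinarith

theorem fderiv_radialBump (p : Pt) (ρ : ℝ) (x v : Pt) :
    fderiv ℝ (radialBump p ρ) x v =
      - (deriv expNegInvGlue (ρ ^ 2 - ‖x - p‖ ^ 2) * (2 * inner ℝ (x - p) v)) := by
  have h1 : HasFDerivAt (fun x : Pt => x - p) (ContinuousLinearMap.id ℝ Pt) x :=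
    (hasFDerivAt_id x).sub_const p
  have h2 := h1.norm_sq.const_sub (ρ ^ 2)
  have h3 : HasDerivAt expNegInvGlue (deriv expNegInvGlue (ρ ^ 2 - ‖x - p‖ ^ 2))
      (ρ ^ 2 - ‖x - p‖ ^ 2) :=
    ((expNegInvGlue.contDiff (n := 1)).differentiable (by simp) _).hasDerivAt
  have h4 : HasFDerivAt (radialBump p ρ) _ x := h3.comp_hasFDerivAt x h2
  rw [h4.fderiv]
  simp [inner_sub_left]

theorem fderiv_radialBump_nonpos {p : Pt} {ρ : ℝ} {x v : Pt} (h : 0 ≤ inner ℝ (x - p) v) :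
    fderiv ℝ (radialBump p ρ) x v ≤ 0 := by
  rw [fderiv_radialBump, neg_nonpos]
  have : 0 ≤ deriv expNegInvGlue (ρ ^ 2 - ‖x - p‖ ^ 2) := expNegInvGlue.monotone.deriv_nonneg
  positivity

/-- Along every ray from its centre the bump decreases strictly somewhere inside the disc. -/
theorem exists_fderiv_radialBump_ne_zero {p v : Pt} {ρ : ℝ} (hρ : 0 < ρ) (hv : v ≠ 0) :
    ∃ t : ℝ, 0 < t ∧ p + t • v ∈ Metric.ball p ρ ∧ fderiv ℝ (radialBump p ρ) (p + t • v) v ≠ 0 := by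
  have hv' : 0 < ‖v‖ := norm_pos_iff.2 hv
  have hτ : 0 < ρ / ‖v‖ := by positivity
  have hd : ∀ t : ℝ, HasDerivAt (fun t : ℝ => radialBump p ρ (p + t • v))
      (fderiv ℝ (radialBump p ρ) (p + t • v) v) t := by
    intro t
    have h1 : HasDerivAt (fun t : ℝ => p + t • v) v t := by
      simpa using ((hasDerivAt_id t).smul_const v).const_add p
    exact (((contDiff_radialBump p ρ).differentiable (by simp)) _).hasFDerivAt.comp_hasDerivAt t h1
  -- Mean value theorem between the centre, where the bump is positive, and the circle, where it is
  -- zero.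
  obtain ⟨t, ht, he⟩ := exists_hasDerivAt_eq_slope (fun t : ℝ => radialBump p ρ (p + t • v)) _ hτ
    (fun t _ => (hd t).continuousAt.continuousWithinAt) fun t _ => hd t
  refine ⟨t, ht.1, ?_, ?_⟩
  · rw [Metric.mem_ball, dist_eq_norm, add_sub_cancel_left, norm_smul, Real.norm_eq_abs,
      abs_of_pos ht.1]
    exact (lt_div_iff₀ hv').1 ht.2
  · rw [he]
    have h0 : radialBump p ρ (p + (ρ / ‖v‖) • v) = 0 := by
      refine radialBump_eq_zero hρ.le ?_
      rw [Metric.mem_ball, dist_eq_norm, add_sub_cancel_left, norm_smul, Real.norm_eq_abs,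
        abs_of_pos hτ, div_mul_cancel₀ _ hv'.ne']
      exact lt_irrefl _
    have h1 : 0 < radialBump p ρ (p + (0 : ℝ) • v) := by
      apply expNegInvGlue.pos_of_pos
      simpa using pow_pos hρ 2
    rw [h0]
    exact div_ne_zero (by linarith) (by linarith)

section Trace

variable {T : TriMesh} {Γ : Finset (Finset Pt)}

/-- The part of the plane away from the boundary edges outside `Γ`. -/
def testRegion (T : TriMesh) (Γ : Finset (Finset Pt)) : Set Pt :=
  (closure (frontier T.body \ edgeUnion Γ))ᶜ

/-- Near a point inside an edge of `Γ` that belongs to one element only, the mesh consists of that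
element, and test functions need not vanish on the boundary. -/
theorem exists_ball_of_boundaryEdge {K : Finset Pt} (hK : K ∈ T.cells) {a b c : Pt}
    (hKe : K = {a, b, c}) (hab : a ≠ b) (hac : a ≠ c) (hbc : b ≠ c)
    (huniq : ∀ K' ∈ T.cells, {a, b} ⊆ K' → K' = K) (hΓ : {a, b} ∈ Γ) {p : Pt}
    (ha : 0 < bary K a p) (hb : 0 < bary K b p) (hc : bary K c p = 0) :
    ∃ r > 0, Metric.ball p r ∩ T.closedBody ⊆ convexHull ℝ (K : Set Pt) ∧
      Metric.ball p r ⊆ testRegion T Γ ∧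
      ∀ x ∈ Metric.ball p r, 0 < bary K a x ∧ 0 < bary K b x := by
  have hpK : p ∈ convexHull ℝ (K : Set Pt) := by
    rw [(T.isTriangle hK).mem_convexHull]
    intro v hv
    rw [hKe] at hv
    simp only [Finset.mem_insert, Finset.mem_singleton] at hv
    rcases hv with rfl | rfl | rfl
    · exact ha.le
    · exact hb.le
    · exact hc.ge
  -- The coordinates of a and b at p are positive, so any element containing p has a and b among its
  -- vertices.
  have hnot : ∀ K' ∈ T.cells, K' ≠ K → p ∉ convexHull ℝ (K' : Set Pt) := by
    intro K' hK' hne hp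
    apply hne
    apply huniq K' hK'
    have hmem : ∀ v, 0 < bary K v p → v ∈ K' := by
      intro v hv
      by_contra hvK
      rw [T.bary_congr hK hK' hpK hp, bary_of_notMem hvK] at hv
      exact lt_irrefl _ hv
    intro v hv
    rcases Finset.mem_insert.1 hv with rfl | hv
    · exact hmem _ ha
    · rw [Finset.mem_singleton.1 hv]
      exact hmem _ hb
  have hcont : ∀ v, Continuous (bary K v) := fun v => (bary K v).continuous_of_finiteDimensional
  have hev : ∀ᶠ x in nhds p, (∀ K' ∈ T.cells, K' ≠ K → x ∉ convexHull ℝ (K' : Set Pt)) ∧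
      0 < bary K a x ∧ 0 < bary K b x := by
    refine Filter.Eventually.and ?_ (((hcont a).continuousAt.eventually_const_lt ha).and
      ((hcont b).continuousAt.eventually_const_lt hb))
    refine (Filter.eventually_all_finset _).2 fun K' hK' => ?_
    by_cases hne : K' = K
    · exact Filter.Eventually.of_forall fun _ h => absurd hne h
    · filter_upwards [(isClosed_hull K').isOpen_compl.mem_nhds (hnot K' hK' hne)] with x hx _
      exact hx
  obtain ⟨r, hr, hball⟩ := Metric.eventually_nhds_iff_ball.1 hev
  have h1 : Metric.ball p r ∩ T.closedBody ⊆ convexHull ℝ (K : Set Pt) := by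
    rintro x ⟨hx, hxU⟩
    obtain ⟨K', hK', hxK'⟩ := TriMesh.mem_closedBody.1 hxU
    by_cases hne : K' = K
    · rwa [hne] at hxK'
    · exact absurd hxK' ((hball x hx).1 K' hK' hne)
  refine ⟨r, hr, h1, ?_, fun x hx => (hball x hx).2⟩
  -- A boundary point of the body in this ball belongs to K. Its coordinate at c vanishes, since
  -- otherwise it would be interior to K; hence it lies on the edge from a to b.
  have hdisj : Disjoint (Metric.ball p r) (frontier T.body \ edgeUnion Γ) := by
    rw [Set.disjoint_left]
    rintro x hx ⟨hxf, hxe⟩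
    rw [T.frontier_body] at hxf
    have hxK := h1 ⟨hx, hxf.1⟩
    have hcx : bary K c x = 0 := by
      refine le_antisymm ?_ ((T.isTriangle hK).mem_convexHull.1 hxK c (by rw [hKe]; simp))
      by_contra! hpos
      refine hxf.2 (T.interior_subset_body hK ((T.isTriangle hK).mem_interior.2 fun v hv => ?_))
      rw [hKe] at hv
      simp only [Finset.mem_insert, Finset.mem_singleton] at hv
      rcases hv with rfl | rfl | rfl
      · exact (hball x hx).2.1
      · exact (hball x hx).2.2
      · exact hpos
    apply hxe
    refine Set.mem_biUnion hΓ ?_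
    have h2 := (T.isTriangle hK).sum_bary x
    have h3 := (T.isTriangle hK).sum_bary_smul x
    have hna : a ∉ ({b, c} : Finset Pt) := by simp [hab, hac]
    have hnb : b ∉ ({c} : Finset Pt) := by simp [hbc]
    have hsum : ∀ {M : Type} [AddCommMonoid M] (g : Pt → M), ∑ v ∈ K, g v = g a + (g b + g c) := by
      intro M _ g
      rw [hKe, Finset.sum_insert hna, Finset.sum_insert hnb, Finset.sum_singleton]
    rw [hsum, hcx, add_zero] at h2
    rw [hsum, hcx, zero_smul, add_zero] at h3
    rw [Finset.coe_pair, convexHull_pair]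
    exact ⟨_, _, (hball x hx).2.1.le, (hball x hx).2.2.le, h2, h3⟩
  exact Set.subset_compl_iff_disjoint_right.2 (hdisj.closure_right Metric.isOpen_ball)

/-- The quotient of the radial bump by a polynomial without zeros near the disc. -/
theorem isTest_radialBump_div {p : Pt} {r : ℝ} (hr : 0 < r) {q : Poly2} {s : Set Pt}
    (hq : ∀ x ∈ Metric.ball p r, evalAt x q ≠ 0) (hs : Metric.ball p r ⊆ s) :
    IsTest s fun x => radialBump p (r / 2) x / evalAt x q := by
  -- Half the radius keeps the closed support inside the disc on which q has no zeros.
  have hsub : Function.support (fun x => radialBump p (r / 2) x / evalAt x q) ⊆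
      Metric.closedBall p (r / 2) := by
    intro x hx
    by_contra hxb
    apply hx
    beta_reduce
    rw [radialBump_eq_zero (by linarith) fun h => hxb (Metric.ball_subset_closedBall h), zero_div]
  have hts : tsupport (fun x => radialBump p (r / 2) x / evalAt x q) ⊆
      Metric.closedBall p (r / 2) := closure_minimal hsub Metric.isClosed_closedBall
  have hcb : Metric.closedBall p (r / 2) ⊆ Metric.ball p r :=
    Metric.closedBall_subset_ball (by linarith)
  refine ⟨?_, HasCompactSupport.of_support_subset_isCompact (isCompact_closedBall p (r / 2)) hsub,
    (hts.trans hcb).trans hs⟩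
  rw [contDiff_iff_contDiffAt]
  intro x
  by_cases hx : x ∈ Metric.ball p r
  · exact (contDiff_radialBump p (r / 2)).contDiffAt.div (contDiff_evalAt q).contDiffAt (hq x hx)
  · refine (contDiffAt_const (c := (0 : ℝ))).congr_of_eventuallyEq ?_
    filter_upwards [Metric.isClosed_closedBall.isOpen_compl.mem_nhds
      (show x ∈ (Metric.closedBall p (r / 2))ᶜ from fun h => hx (hcb h))] with y hy
    by_contra hne
    exact hy (hsub hne)

/-- The gradient of a barycentric coordinate. -/
def baryGrad (K : Finset Pt) (c : Pt) : Pt :=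
  !₂[(bary K c).linear (EuclideanSpace.single 0 1), (bary K c).linear (EuclideanSpace.single 1 1)]

theorem inner_baryGrad (K : Finset Pt) (c p x : Pt) :
    inner ℝ (x - p) (baryGrad K c) = bary K c x - bary K c p := by
  have hx : x - p = ∑ i, (x - p) i • (EuclideanSpace.single i 1 : Pt) := by
    ext j
    fin_cases j <;> simp
  have h1 : (bary K c).linear (x - p) = bary K c x - bary K c p := by
    simpa using (bary K c).linearMap_vsub x p
  rw [← h1]
  conv_rhs => rw [hx]
  simp [baryGrad, PiLp.inner_apply, Fin.sum_univ_two]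
  ring

/-- If Green's formula holds without boundary term for the test functions of `testRegion T Γ`, then the
piecewise polynomial vanishes inside the edges of `Γ` that belong to one element only. -/
theorem evalAt_eq_zero_of_green {K : Finset Pt} (hK : K ∈ T.cells) {a b c : Pt}
    (hKe : K = {a, b, c}) (hab : a ≠ b) (hac : a ≠ c) (hbc : b ≠ c)
    (huniq : ∀ K' ∈ T.cells, {a, b} ⊆ K' → K' = K) (hΓ : {a, b} ∈ Γ) {p : Pt}
    (ha : 0 < bary K a p) (hb : 0 < bary K b p) (hc : bary K c p = 0)
    {f : LTwo T} {f' : VecField T} {w : Finset Pt → Poly2} (hf : IsPiecewise T f w)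
    (hf' : ∀ j, IsPiecewise T (f' j) fun K => MvPolynomial.pderiv j (w K))
    (hg : ∀ φ, IsTest (testRegion T Γ) φ → ∀ j,
      pairing T f (partialD j φ) = - pairing T (f' j) φ) :
    evalAt p (w K) = 0 := by
  by_contra hq
  obtain ⟨r₁, hr₁, hcell, hreg, hpos⟩ :=
    exists_ball_of_boundaryEdge hK hKe hab hac hbc huniq hΓ ha hb hc
  obtain ⟨r₂, hr₂, hne⟩ := Metric.eventually_nhds_iff_ball.1
    ((contDiff_evalAt (w K)).continuous.continuousAt.eventually_ne hq)
  obtain ⟨r, hr, hrr₁, hrr₂⟩ : ∃ r > 0, Metric.ball p r ⊆ Metric.ball p r₁ ∧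
      Metric.ball p r ⊆ Metric.ball p r₂ :=
    ⟨min r₁ r₂, lt_min hr₁ hr₂, Metric.ball_subset_ball (min_le_left _ _),
      Metric.ball_subset_ball (min_le_right _ _)⟩
  -- Division by the polynomial makes its product with the test function equal to the bump ψ,
  -- whatever the polynomial is. Green's formula then says that the derivative of ψ along `v` has
  -- integral zero over the part of the disc inside K.
  set ψ := radialBump p (r / 2) with hψ
  set φ : Pt → ℝ := fun x => ψ x / evalAt x (w K) with hφ
  have hqne : ∀ x ∈ Metric.ball p r, evalAt x (w K) ≠ 0 := fun x hx => hne x (hrr₂ hx)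
  have htest : IsTest (testRegion T Γ) φ :=
    isTest_radialBump_div hr hqne (hrr₁.trans hreg)
  have hψ0 : ∀ x, x ∉ Metric.ball p r → ψ =ᶠ[nhds x] fun _ => 0 := by
    intro x hx
    filter_upwards [Metric.isClosed_closedBall.isOpen_compl.mem_nhds
      (show x ∈ (Metric.closedBall p (r / 2))ᶜ from
        fun h => hx (Metric.closedBall_subset_ball (by linarith) h))] with y hy
    exact radialBump_eq_zero (by linarith) fun h => hy (Metric.ball_subset_closedBall h)
  have hφ0 : ∀ x, x ∉ Metric.ball p r → φ =ᶠ[nhds x] fun _ => 0 := by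
    intro x hx
    filter_upwards [hψ0 x hx] with y hy
    rw [hφ]
    simp [hy]
  have hprod : (fun x => evalAt x (w K) * φ x) = ψ := by
    ext1 x
    by_cases hx : x ∈ Metric.ball p r
    · exact mul_div_cancel₀ _ (hqne x hx)
    · rw [(hφ0 x hx).self_of_nhds, (hψ0 x hx).self_of_nhds, mul_zero]
  -- Normal to the edge and pointing into K, scaled so that the inner product of x - p with v is the
  -- coordinate of c at x.
  set v := baryGrad K c with hv
  have hψd : Differentiable ℝ ψ := (contDiff_radialBump p (r / 2)).differentiable (by simp)
  have hjd : ∀ j x, evalAt x (w K) * partialD j φ x +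
      evalAt x (MvPolynomial.pderiv j (w K)) * φ x =
        fderiv ℝ ψ x (EuclideanSpace.single j 1) := by
    intro j x
    rw [← lineDeriv_evalAt_mul htest.smooth, hprod, (hψd x).lineDeriv_eq_fderiv]
  have hvsum : ∀ x, fderiv ℝ ψ x v = ∑ j, v j * fderiv ℝ ψ x (EuclideanSpace.single j 1) := by
    intro x
    have hx : v = ∑ i, v i • (EuclideanSpace.single i 1 : Pt) := by
      ext j
      fin_cases j <;> simp
    conv_lhs => rw [hx]
    simp
  have hint : ∀ j, Integrable (fun x => f x * partialD j φ x + f' j x * φ x) (bodyMeasure T) :=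
    fun j => ((Lp.memLp f).integrable_mul (htest.memLp_partialD T j)).add
      ((Lp.memLp (f' j)).integrable_mul (htest.memLp T))
  have hzero : ∀ j, ∫ x, (f x * partialD j φ x + f' j x * φ x) ∂(bodyMeasure T) = 0 := by
    intro j
    have h1 := integral_add ((Lp.memLp f).integrable_mul (htest.memLp_partialD T j))
      ((Lp.memLp (f' j)).integrable_mul (htest.memLp T))
    have h2 := hg φ htest j
    rw [pairing, pairing] at h2
    refine h1.trans ?_
    simp only [Pi.mul_apply]
    linarith
  have hae : ∀ᵐ x ∂(bodyMeasure T), ∑ j, v j * (f x * partialD j φ x + f' j x * φ x) =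
      (interior (convexHull ℝ (K : Set Pt))).indicator (fun x => fderiv ℝ ψ x v) x := by
    filter_upwards [ae_mem_cell T, (Filter.eventually_all_finset T.cells).2 hf,
      Filter.eventually_all.2 fun j => (Filter.eventually_all_finset T.cells).2 (hf' j)]
      with x ⟨K', hK', hx⟩ hfx hfx'
    by_cases hxr : x ∈ Metric.ball p r
    · have hxK := hcell ⟨hrr₁ hxr, TriMesh.mem_closedBody.2 ⟨K', hK', interior_subset hx⟩⟩
      have hKK := T.disjoint_interior hK' hK hx hxK
      rw [hKK] at hx
      rw [Set.indicator_of_mem hx, hvsum]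
      refine Finset.sum_congr rfl fun j _ => ?_
      rw [hfx K hK hxK, hfx' j K hK hxK, hjd]
    · have h1 : fderiv ℝ ψ x = 0 := by rw [(hψ0 x hxr).fderiv_eq]; simp
      have h2 : ∀ j, partialD j φ x = 0 := fun j => by
        rw [partialD, (hφ0 x hxr).fderiv_eq]; simp
      have h3 : φ x = 0 := (hφ0 x hxr).self_of_nhds
      simp [h1, h2, h3, Set.indicator]
  have hI : Integrable ((interior (convexHull ℝ (K : Set Pt))).indicator
      (fun x => fderiv ℝ ψ x v)) (bodyMeasure T) :=
    (integrable_finsetSum _ fun j _ => (hint j).const_mul (v j)).congr hae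
  have hI0 : ∫ x, (interior (convexHull ℝ (K : Set Pt))).indicator
      (fun x => fderiv ℝ ψ x v) x ∂(bodyMeasure T) = 0 := by
    rw [← integral_congr_ae hae, integral_finsetSum _ fun j _ => (hint j).const_mul (v j)]
    refine Finset.sum_eq_zero fun j _ => ?_
    rw [integral_const_mul, hzero, mul_zero]
  -- Inside K the bump does not increase along v, so a zero integral forces its derivative to vanish
  -- there.
  have hsign : ∀ x ∈ interior (convexHull ℝ (K : Set Pt)), fderiv ℝ ψ x v ≤ 0 := by
    intro x hx
    refine fderiv_radialBump_nonpos ?_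
    rw [hv, inner_baryGrad, hc, sub_zero]
    exact ((T.isTriangle hK).mem_interior.1 hx c (by rw [hKe]; simp)).le
  have hIz : ∀ᵐ x ∂(bodyMeasure T), (interior (convexHull ℝ (K : Set Pt))).indicator
      (fun x => fderiv ℝ ψ x v) x = 0 := by
    have h1 := (integral_eq_zero_iff_of_nonneg (μ := bodyMeasure T) (f := fun x =>
      -(interior (convexHull ℝ (K : Set Pt))).indicator (fun x => fderiv ℝ ψ x v) x) (fun x => ?_)
      hI.neg).1 (by rw [integral_neg, hI0, neg_zero])
    · filter_upwards [h1] with x hx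
      exact neg_eq_zero.1 hx
    · by_cases hx : x ∈ interior (convexHull ℝ (K : Set Pt))
      · simpa [hx] using hsign x hx
      · simp [hx]
  have hUz : ∀ x ∈ interior (convexHull ℝ (K : Set Pt)), fderiv ℝ ψ x v = 0 := by
    have hcd : Continuous fun x => fderiv ℝ ψ x v :=
      ((contDiff_radialBump p (r / 2)).continuous_fderiv (by simp)).clm_apply continuous_const
    have h1 : (fun x => fderiv ℝ ψ x v)
        =ᵐ[volume.restrict (interior (convexHull ℝ (K : Set Pt)))] fun _ => 0 := by
      filter_upwards [ae_mono (Measure.restrict_mono (T.interior_subset_body hK) le_rfl) hIz,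
        ae_restrict_mem isOpen_interior.measurableSet] with x hx hxi
      rwa [Set.indicator_of_mem hxi] at hx
    intro x hx
    exact Measure.eqOn_open_of_ae_eq h1 isOpen_interior hcd.continuousOn
      continuous_const.continuousOn hx
  have hinner : ∀ x, inner ℝ (x - p) v = bary K c x := fun x => by
    rw [hv, inner_baryGrad, hc, sub_zero]
  have hv0 : v ≠ 0 := by
    intro h0
    have h1 := hinner c
    rw [h0, inner_zero_right, (T.isTriangle hK).bary_self (by rw [hKe]; simp)] at h1
    exact zero_ne_one h1
  -- Within the small disc the ray from p along v runs inside K, yet the bump has to decrease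
  -- somewhere on it.
  obtain ⟨t, ht, htb, htne⟩ := exists_fderiv_radialBump_ne_zero (p := p) (v := v)
    (show 0 < r / 2 by linarith) hv0
  refine htne (hUz _ ((T.isTriangle hK).mem_interior.2 fun z hz => ?_))
  have hmem := hpos _ (hrr₁ (Metric.ball_subset_ball (by linarith) htb))
  rw [hKe] at hz
  simp only [Finset.mem_insert, Finset.mem_singleton] at hz
  rcases hz with rfl | rfl | rfl
  · exact hmem.1
  · exact hmem.2
  · rw [← hinner, add_sub_cancel_left, inner_smul_left, real_inner_self_eq_norm_sq]
    have : 0 < ‖v‖ := norm_pos_iff.2 hv0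
    simp only [conj_trivial]
    positivity

/-- If Green's formula holds without boundary term for the test functions of `testRegion T Γ`, then the
piecewise polynomial vanishes at the end points of the boundary edges in `Γ`. -/
theorem evalAt_vertex_eq_zero_of_green (hΓb : (Γ : Set (Finset Pt)) ⊆ T.boundaryEdges)
    {f : LTwo T} {f' : VecField T} {w : Finset Pt → Poly2} (hf : IsPiecewise T f w)
    (hf' : ∀ j, IsPiecewise T (f' j) fun K => MvPolynomial.pderiv j (w K))
    (hg : ∀ φ, IsTest (testRegion T Γ) φ → ∀ j,
      pairing T f (partialD j φ) = - pairing T (f' j) φ) {e : Finset Pt} (he : e ∈ Γ) :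
    ∃ K ∈ T.cells, e ⊆ K ∧ ∀ a ∈ e, evalAt a (w K) = 0 := by
  obtain ⟨⟨he2, -⟩, K, ⟨hK, heK⟩, huniq⟩ := hΓb he
  refine ⟨K, hK, heK, ?_⟩
  have key : ∀ a b, a ≠ b → e = {a, b} → evalAt a (w K) = 0 := by
    intro a b hab hee
    have haK : a ∈ K := heK (by rw [hee]; simp)
    have hbK : b ∈ K := heK (by rw [hee]; simp)
    obtain ⟨c, hc⟩ : ∃ c, K \ e = {c} := by
      rw [← Finset.card_eq_one, Finset.card_sdiff_of_subset heK, T.card_eq K hK, he2]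
    have hcm : c ∈ K \ e := by rw [hc]; simp
    rw [Finset.mem_sdiff, hee] at hcm
    simp only [Finset.mem_insert, Finset.mem_singleton, not_or] at hcm
    have hKe : K = {a, b, c} := by
      rw [← Finset.union_sdiff_of_subset heK, hc, hee]
      ext x; simp
    -- The boundary condition is accessible only inside the edge; the end point a is then reached by
    -- continuity.
    have hz : ∀ t ∈ Set.Ioo (0 : ℝ) 1, evalAt (AffineMap.lineMap a b t) (w K) = 0 := by
      intro t ht
      have hval : ∀ v, bary K v (AffineMap.lineMap a b t) =
          (1 - t) * bary K v a + t * bary K v b := fun v => by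
        rw [AffineMap.apply_lineMap, AffineMap.lineMap_apply_ring]
      have hT := T.isTriangle hK
      refine evalAt_eq_zero_of_green hK hKe hab (Ne.symm hcm.2.1) (Ne.symm hcm.2.2)
        (fun K' hK' hs => huniq K' ⟨hK', hee ▸ hs⟩) (hee ▸ he) ?_ ?_ ?_ hf hf' hg
      · rw [hval, hT.bary_self haK, hT.bary_of_ne hbK hab.symm]
        linarith [ht.2]
      · rw [hval, hT.bary_self hbK, hT.bary_of_ne haK hab]
        linarith [ht.1]
      · rw [hval, hT.bary_of_ne haK (Ne.symm hcm.2.1), hT.bary_of_ne hbK (Ne.symm hcm.2.2)]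
        ring
    have hcl : IsClosed {t : ℝ | evalAt (AffineMap.lineMap a b t) (w K) = 0} :=
      isClosed_eq ((contDiff_evalAt (w K)).continuous.comp AffineMap.lineMap_continuous)
        continuous_const
    have h0 : (0 : ℝ) ∈ {t : ℝ | evalAt (AffineMap.lineMap a b t) (w K) = 0} := by
      refine closure_minimal hz hcl ?_
      rw [closure_Ioo zero_ne_one]
      simp
    simpa using h0
  obtain ⟨a, b, hab, hee⟩ := Finset.card_eq_two.1 he2
  intro x hx
  rw [hee] at hx
  rcases Finset.mem_insert.1 hx with rfl | hx
  · exact key _ _ hab hee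
  · rw [Finset.mem_singleton.1 hx]
    exact key _ _ hab.symm (by rw [hee, Finset.pair_comm])

end Trace

/-! Dimensions of Lagrange spaces with boundary conditions. -/

section LagrangeDim

variable {T : TriMesh} {Γ : Finset (Finset Pt)}

theorem mem_hull {K : Finset Pt} {v : Pt} (hv : v ∈ K) : v ∈ convexHull ℝ (K : Set Pt) :=
  subset_convexHull ℝ _ hv

/-- Piecewise affine displacements are determined by their values at the vertices where they are not
forced to vanish. -/
theorem finrank_elemL_one_le (hΓ : (Γ : Set (Finset Pt)) ⊆ T.boundaryEdges) {R : Finset Pt}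
    (hR : ∀ a ∈ R, ∃ e ∈ Γ, a ∈ e) :
    Module.finrank ℝ (elemL T 1 ⊓ HOneVanishing T Γ : Submodule ℝ (GradPair T)) ≤
      2 * (T.vertexFinset \ R).card := by
  have hcell : ∀ v : (T.vertexFinset \ R : Finset Pt), ∃ K ∈ T.cells, v.1 ∈ K := fun v =>
    TriMesh.mem_vertexFinset.1 (Finset.mem_sdiff.1 v.2).1
  choose L hL hvL using hcell
  let μ : GradPair T →ₗ[ℝ] (Fin 2 × (T.vertexFinset \ R : Finset Pt) → ℝ) := LinearMap.pi fun iv =>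
    evalLin iv.2 ∘ₗ piece T (L iv.2) ∘ₗ LinearMap.proj iv.1 ∘ₗ LinearMap.fst ℝ _ _
  have hinj : Function.Injective
      (μ ∘ₗ (elemL T 1 ⊓ HOneVanishing T Γ : Submodule ℝ (GradPair T)).subtype) := by
    rw [← LinearMap.ker_eq_bot, LinearMap.ker_eq_bot']
    rintro ⟨u, hu, hu'⟩ h0
    have h0 : ∀ i v, evalAt v.1 (piece T (L v) (u.1 i)) = 0 := fun i v => congrFun h0 (i, v)
    have hrow : ∀ i, u.1 i = 0 ∧ ∀ j, u.2 i j = 0 := by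
      intro i
      obtain ⟨w, hw, hc, hp, hd⟩ := hu i
      have hwz : ∀ K ∈ T.cells, w K = 0 := by
        intro K hK
        refine poly_eq_zero_of_degree_one (T.isTriangle hK) (hw K hK) fun a ha => ?_
        -- At a vertex in R the value is zero in the element on the boundary edge, and continuity
        -- transfers it to K; elsewhere it is one of the degrees of freedom.
        by_cases haR : a ∈ R
        · obtain ⟨e, he, hae⟩ := hR a haR
          obtain ⟨K', hK', heK', hz⟩ := evalAt_vertex_eq_zero_of_green hΓ hp hd
            (fun φ hφ j => hu'.2 φ hφ i j) he
          rw [hc K hK K' hK' a ⟨mem_hull ha, mem_hull (heK' hae)⟩]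
          exact hz a hae
        · have hav : a ∈ T.vertexFinset \ R :=
            Finset.mem_sdiff.2 ⟨TriMesh.mem_vertexFinset.2 ⟨K, hK, ha⟩, haR⟩
          have h1 := h0 i ⟨a, hav⟩
          rw [hp.piece_eq (hL _)] at h1
          rw [hc K hK (L ⟨a, hav⟩) (hL _) a ⟨mem_hull ha, mem_hull (hvL ⟨a, hav⟩)⟩]
          exact h1
      exact ⟨hp.eq_zero hwz, fun j => (hd j).eq_zero fun K hK => by rw [hwz K hK, map_zero]⟩
    refine Subtype.ext (Prod.ext ?_ ?_)
    · ext1 i; exact (hrow i).1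
    · ext1 i; ext1 j; exact (hrow i).2 j
  have := LinearMap.finrank_le_finrank_of_injective hinj
  rw [Module.finrank_fintype_fun_eq_card] at this
  simpa using this

/-! ### Quadratic fields that vanish on boundary edges -/

/-- The hierarchical quadratic Lagrange basis: barycentric coordinates at the vertices and products of
two of them on the edges. -/
def hierBasis (A : Finset Pt) (B : Finset (Finset Pt)) : A ⊕ B → Finset Pt → Poly2
  | Sum.inl v => fun K => affPoly (bary K v)
  | Sum.inr e => fun K => ∏ a ∈ e.1, affPoly (bary K a)

variable {A : Finset Pt} {B : Finset (Finset Pt)}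

theorem hierBasis_degree (hB : B ⊆ T.edgeFinset) (n : A ⊕ B) (K : Finset Pt) :
    hierBasis A B n K ∈ MvPolynomial.restrictTotalDegree (Fin 2) ℝ 2 := by
  rw [MvPolynomial.mem_restrictTotalDegree]
  have h1 : ∀ v, (affPoly (bary K v)).totalDegree ≤ 1 := fun v =>
    (MvPolynomial.mem_restrictTotalDegree _ _ _).1 (affPoly_mem _)
  rcases n with v | e
  · exact (h1 v).trans one_le_two
  · refine (MvPolynomial.totalDegree_finsetProd _ _).trans ?_
    refine (Finset.sum_le_card_nsmul _ _ 1 fun a _ => h1 a).trans ?_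
    rw [(TriMesh.mem_edgeFinset.1 (hB e.2)).1]
    simp

theorem hierBasis_continuous (n : A ⊕ B) : IsContinuousFamily T (hierBasis A B n) := by
  intro K hK K' hK' x hx
  rcases n with v | e
  · simp only [hierBasis, evalAt_affPoly]
    exact T.bary_congr hK hK' hx.1 hx.2 v
  · simp only [hierBasis, map_prod, evalAt_affPoly]
    exact Finset.prod_congr rfl fun a _ => T.bary_congr hK hK' hx.1 hx.2 a

/-- On an edge e of Γ the coordinates of all vertices outside e are zero, and each basis function
has such a factor: the vertices in A avoid Γ, and an edge other than e has an end point outside e.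
-/
theorem hierBasis_vanishing (hΓ : Γ ⊆ T.edgeFinset) (hB : B ⊆ T.edgeFinset)
    (hA : ∀ v ∈ A, ∀ e ∈ Γ, v ∉ e) (hBΓ : Disjoint B Γ) (n : A ⊕ B) {K : Finset Pt}
    (hK : K ∈ T.cells) {x : Pt} (hx : x ∈ convexHull ℝ (K : Set Pt)) (hxΓ : x ∈ edgeUnion Γ) :
    evalAt x (hierBasis A B n K) = 0 := by
  obtain ⟨e, he, hxe⟩ := Set.mem_iUnion₂.1 hxΓ
  obtain ⟨he2, K', hK', heK'⟩ := TriMesh.mem_edgeFinset.1 (hΓ he)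
  rw [hierBasis_continuous n K hK K' hK' x ⟨hx, convexHull_mono heK' hxe⟩]
  have hz : ∀ v, v ∉ e → bary K' v x = 0 := fun v hv =>
    bary_eq_zero_of_mem_convexHull (T.isTriangle hK') heK' hv hxe
  rcases n with v | e'
  · simp only [hierBasis, evalAt_affPoly]
    exact hz v (hA v v.2 e he)
  · simp only [hierBasis, map_prod, evalAt_affPoly]
    obtain ⟨a, ha, hae⟩ : ∃ a ∈ e'.1, a ∉ e := by
      by_contra! hsub
      have h1 := Finset.eq_of_subset_of_card_le hsub
        (by rw [he2, (TriMesh.mem_edgeFinset.1 (hB e'.2)).1])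
      exact Finset.disjoint_left.1 hBΓ e'.2 (h1 ▸ he)
    exact Finset.prod_eq_zero ha (hz a hae)

/-- The system is triangular: the edge functions vanish at all vertices, so vertex values isolate
the coefficients of A; after that the midpoint of an edge isolates its coefficient. -/
theorem hierBasis_independent (hA : A ⊆ T.vertexFinset) (hB : B ⊆ T.edgeFinset) {c : A ⊕ B → ℝ}
    (hc : ∀ K ∈ T.cells, ∑ n, c n • hierBasis A B n K = 0) : c = 0 := by
  have hev : ∀ K ∈ T.cells, ∀ x, ∑ n, c n * evalAt x (hierBasis A B n K) = 0 := by
    intro K hK x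
    have := congrArg (evalAt x) (hc K hK)
    simpa only [map_sum, evalAt_smul, map_zero] using this
  have hV : ∀ v : A, c (Sum.inl v) = 0 := by
    intro v
    obtain ⟨K, hK, hvK⟩ := TriMesh.mem_vertexFinset.1 (hA v.2)
    have hT := T.isTriangle hK
    have h1 := hev K hK v
    rw [Finset.sum_eq_single (Sum.inl v)] at h1
    · simpa [hierBasis, evalAt_affPoly, hT.bary_self hvK] using h1
    · rintro (v' | e) _ hne
      · have : v.1 ≠ v'.1 := fun h => hne (by rw [Subtype.ext h])
        simp [hierBasis, evalAt_affPoly, hT.bary_of_ne hvK this]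
      · obtain ⟨a, ha, hav⟩ := Finset.exists_mem_ne
          (by rw [(TriMesh.mem_edgeFinset.1 (hB e.2)).1]; exact one_lt_two) v.1
        simp only [hierBasis, map_prod, evalAt_affPoly]
        have h2 : bary K a v = 0 := hT.bary_of_ne hvK (Ne.symm hav)
        rw [Finset.prod_eq_zero ha h2, mul_zero]
    · exact fun h => absurd (Finset.mem_univ _) h
  have hE : ∀ e : B, c (Sum.inr e) = 0 := by
    intro e
    obtain ⟨he2, K, hK, heK⟩ := TriMesh.mem_edgeFinset.1 (hB e.2)
    have hT := T.isTriangle hK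
    obtain ⟨a, b, hab, hee⟩ := Finset.card_eq_two.1 he2
    have haK : a ∈ K := heK (by rw [hee]; simp)
    have hbK : b ∈ K := heK (by rw [hee]; simp)
    have hval : ∀ v, bary K v (AffineMap.lineMap a b (1 / 2 : ℝ)) =
        (1 / 2) * bary K v a + (1 / 2) * bary K v b := fun v => by
      rw [AffineMap.apply_lineMap, AffineMap.lineMap_apply_ring]
      norm_num
    have h1 := hev K hK (AffineMap.lineMap a b (1 / 2 : ℝ))
    rw [Finset.sum_eq_single (Sum.inr e)] at h1
    · simp only [hierBasis, map_prod, evalAt_affPoly] at h1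
      rw [hee, Finset.prod_pair hab, hval, hval, hT.bary_self haK, hT.bary_self hbK,
        hT.bary_of_ne haK hab, hT.bary_of_ne hbK hab.symm] at h1
      linarith
    · rintro (v | e') _ hne
      · rw [hV, zero_mul]
      · obtain ⟨z, hz, hze⟩ : ∃ z ∈ e'.1, z ∉ e.1 := by
          by_contra! hsub
          have h2 := Finset.eq_of_subset_of_card_le hsub
            (by rw [he2, (TriMesh.mem_edgeFinset.1 (hB e'.2)).1])
          exact hne (by rw [Subtype.ext h2])
        have hza : a ≠ z := fun h => hze (by rw [hee, ← h]; simp)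
        have hzb : b ≠ z := fun h => hze (by rw [hee, ← h]; simp)
        simp only [hierBasis, map_prod, evalAt_affPoly]
        rw [Finset.prod_eq_zero hz (by
          rw [hval, hT.bary_of_ne haK hza, hT.bary_of_ne hbK hzb]; norm_num), mul_zero]
    · exact fun h => absurd (Finset.mem_univ _) h
  ext1 n
  rcases n with v | e
  · exact hV v
  · exact hE e

/-- The family of polynomials with given coefficients in the hierarchical basis. -/
def hierFamily (A : Finset Pt) (B : Finset (Finset Pt)) :
    (A ⊕ B → ℝ) →ₗ[ℝ] (Finset Pt → Poly2) := Fintype.linearCombination ℝ (hierBasis A B)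

theorem hierFamily_apply (c : A ⊕ B → ℝ) (K : Finset Pt) :
    hierFamily A B c K = ∑ n, c n • hierBasis A B n K := by
  simp [hierFamily, Fintype.linearCombination_apply, Finset.sum_apply]

theorem evalAt_hierFamily (c : A ⊕ B → ℝ) (K : Finset Pt) (x : Pt) :
    evalAt x (hierFamily A B c K) = ∑ n, c n * evalAt x (hierBasis A B n K) := by
  simp only [hierFamily_apply, map_sum, evalAt_smul]

/-- The displacement with given coefficients in the hierarchical basis. -/
def hierField (T : TriMesh) (A : Finset Pt) (B : Finset (Finset Pt)) :
    (Fin 2 → A ⊕ B → ℝ) →ₗ[ℝ] GradPair T :=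
  (LinearMap.pi fun i => assemble T ∘ₗ hierFamily A B ∘ₗ LinearMap.proj i).prod
    (LinearMap.pi fun i => LinearMap.pi fun j => assemble T ∘ₗ
      (MvPolynomial.pderiv j).toLinearMap.compLeft (Finset Pt) ∘ₗ hierFamily A B ∘ₗ
        LinearMap.proj i)

theorem hierField_fst (c : Fin 2 → A ⊕ B → ℝ) (i : Fin 2) :
    IsPiecewise T ((hierField T A B c).1 i) (hierFamily A B (c i)) := assemble_spec T _

theorem hierField_snd (c : Fin 2 → A ⊕ B → ℝ) (i j : Fin 2) :
    IsPiecewise T ((hierField T A B c).2 i j)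
      fun K => MvPolynomial.pderiv j (hierFamily A B (c i) K) := assemble_spec T _

theorem hierFamily_continuous (c : A ⊕ B → ℝ) : IsContinuousFamily T (hierFamily A B c) := by
  intro K hK K' hK' x hx
  rw [evalAt_hierFamily, evalAt_hierFamily]
  exact Finset.sum_congr rfl fun n _ => by rw [hierBasis_continuous n K hK K' hK' x hx]

theorem hierField_mem_elemL (hB : B ⊆ T.edgeFinset) (c : Fin 2 → A ⊕ B → ℝ) :
    hierField T A B c ∈ elemL T 2 := by
  intro i
  refine ⟨hierFamily A B (c i), fun K _ => ?_, hierFamily_continuous _, hierField_fst c i,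
    hierField_snd c i⟩
  rw [hierFamily_apply]
  exact Submodule.sum_mem _ fun n _ => Submodule.smul_mem _ _ (hierBasis_degree hB n K)

/-- A boundary point in the support of an admissible test function must lie on Γ, where the basis
functions vanish; at all other boundary points the test function is zero. Hence the product vanishes
on the whole boundary. -/
theorem hierField_mem_weakGrad (hΓ : Γ ⊆ T.edgeFinset) (hB : B ⊆ T.edgeFinset)
    (hA : ∀ v ∈ A, ∀ e ∈ Γ, v ∉ e) (hBΓ : Disjoint B Γ) (c : Fin 2 → A ⊕ B → ℝ) :
    hierField T A B c ∈ weakGrad T (testRegion T Γ) := by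
  intro φ hφ i j
  refine green_of_vanishing (hierFamily_continuous (c i)) hφ.smooth (hφ.memLp T)
    (hφ.memLp_partialD T j) (fun K hK x hx hxf => ?_) (hierField_fst c i) (hierField_snd c i j)
  by_cases hxs : x ∈ tsupport φ
  · have hxΓ : x ∈ edgeUnion Γ := by
      by_contra hxe
      exact hφ.supp hxs (subset_closure ⟨hxf, hxe⟩)
    rw [evalAt_hierFamily, Finset.sum_eq_zero fun n _ => by
      rw [hierBasis_vanishing hΓ hB hA hBΓ n hK hx hxΓ, mul_zero], zero_mul]
  · rw [image_eq_zero_of_notMem_tsupport hxs, mul_zero]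

theorem hierField_injective (hA : A ⊆ T.vertexFinset) (hB : B ⊆ T.edgeFinset) :
    Function.Injective (hierField T A B) := by
  rw [← LinearMap.ker_eq_bot, LinearMap.ker_eq_bot']
  intro c hc
  ext1 i
  refine hierBasis_independent hA hB fun K hK => ?_
  have h1 := hierField_fst (T := T) c i
  rw [hc] at h1
  rw [← hierFamily_apply]
  exact h1.unique (IsPiecewise.zero T) hK

/-- A lower bound for the dimension of the quadratic displacements that vanish on `Γ`. -/
theorem two_mul_card_le_n1 (F : FEChoice T) (hF : F.V1 = elemL T 2) (hΓ : Γ ⊆ T.edgeFinset)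
    (hA : A ⊆ T.vertexFinset) (hB : B ⊆ T.edgeFinset) (hAΓ : ∀ v ∈ A, ∀ e ∈ Γ, v ∉ e)
    (hBΓ : Disjoint B Γ) : 2 * (A.card + B.card) ≤ F.n1 Γ := by
  have hmem : ∀ c, hierField T A B c ∈ F.V1van Γ := fun c => by
    have h1 : hierField T A B c ∈ F.V1 := by rw [hF]; exact hierField_mem_elemL hB c
    -- Membership in H¹ is supplied by the conformity of the given space.
    exact ⟨h1, F.conf1 h1, hierField_mem_weakGrad hΓ hB hAΓ hBΓ c⟩
  have h := LinearMap.finrank_le_finrank_of_injective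
    (f := (hierField T A B).codRestrict (F.V1van Γ) hmem)
    fun c d h => hierField_injective hA hB (congrArg Subtype.val h)
  rw [Module.finrank_pi_fintype] at h
  simp only [Module.finrank_fintype_fun_eq_card, Fintype.card_sum, Fintype.card_coe,
    Finset.sum_const, Finset.card_univ, Fintype.card_fin, smul_eq_mul] at h
  exact h

end LagrangeDim

/-! The four patterns. -/

theorem TriMesh.subset_edgeFinset {T : TriMesh} {Γ : Finset (Finset Pt)}
    (hΓ : (Γ : Set (Finset Pt)) ⊆ T.boundaryEdges) : Γ ⊆ T.edgeFinset := fun _ he =>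
  TriMesh.mem_edgeFinset.2 (hΓ he).1

/-- With v and e the numbers of vertices and edges on Γ, the bounds are 2 (N_v - v + N_e - e) from
below and 2 N_e from above; v + e < N_v is what separates them. -/
theorem n1_gt_nd_of_L2_R1 {T : TriMesh} {Γ : Finset (Finset Pt)}
    (hΓ : (Γ : Set (Finset Pt)) ⊆ T.boundaryEdges) (F : FEChoice T) (h1 : F.V1 = elemL T 2)
    (hd : F.Vd = elemR1 T) (hc : (edgeVertices Γ).ncard + Γ.card < T.vertices.ncard) :
    F.n1 Γ > F.nd := by
  classical
  have hΓ' := TriMesh.subset_edgeFinset hΓ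
  have hnd : F.nd ≤ 2 * T.edgeFinset.card := by
    rw [FEChoice.nd, hd]
    exact finrank_elemR1_le T
  have hVΓ : ((Γ.biUnion id : Finset Pt) : Set Pt) = edgeVertices Γ := by
    ext a
    simp [edgeVertices]
  rw [← hVΓ, ← T.coe_vertexFinset, Set.ncard_coe_finset, Set.ncard_coe_finset] at hc
  have h2 := two_mul_card_le_n1 (A := T.vertexFinset \ Γ.biUnion id) (B := T.edgeFinset \ Γ) F h1
    hΓ' Finset.sdiff_subset Finset.sdiff_subset
    (fun v hv e he hve => (Finset.mem_sdiff.1 hv).2 (Finset.mem_biUnion.2 ⟨e, he, hve⟩))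
    Finset.sdiff_disjoint
  have h3 := Finset.le_card_sdiff (Γ.biUnion id) T.vertexFinset
  have h4 := Finset.card_sdiff_of_subset hΓ'
  have h5 := Finset.card_le_card hΓ'
  omega

/-- n_c ≤ 2 N_e < 6 N_el ≤ n_D. -/
theorem nD_gt_nc_of_N11_D2 {T : TriMesh} (F : FEChoice T) (hc : F.Vc = elemN11 T)
    (hD : F.VD = elemD T 2) (h2 : 2 ≤ T.cells.card) : F.nD > F.nc := by
  have h1 : F.nc ≤ 2 * T.edgeFinset.card := by
    rw [FEChoice.nc, hc]
    exact (finrank_elemN11 T).2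
  have h3 := six_mul_card_le_nD F hD
  have h4 := T.card_edgeFinset_lt h2
  omega

/-- Two values per vertex, and N_v ≤ N_el + 2. The end points of a single edge of Γ already remove
the two extra vertices. -/
theorem n1_le_of_L1 {T : TriMesh} {Γ : Finset (Finset Pt)}
    (hΓ : (Γ : Set (Finset Pt)) ⊆ T.boundaryEdges) (F : FEChoice T) (h1 : F.V1 = elemL T 1) :
    F.n1 Γ ≤ 2 * (T.cells.card + 2) ∧ (Γ.Nonempty → F.n1 Γ ≤ 2 * T.cells.card) := by
  classical
  have hv := T.card_vertexFinset_le
  rw [FEChoice.n1, FEChoice.V1van, h1]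
  constructor
  · have h := finrank_elemL_one_le hΓ (R := ∅) (by simp)
    rw [Finset.sdiff_empty] at h
    omega
  · rintro ⟨e, he⟩
    have h := finrank_elemL_one_le hΓ (R := e) fun a ha => ⟨e, he, ha⟩
    obtain ⟨he2, K, hK, heK⟩ := TriMesh.mem_edgeFinset.1 (TriMesh.subset_edgeFinset hΓ he)
    rw [Finset.card_sdiff_of_subset fun a ha => TriMesh.mem_vertexFinset.2 ⟨K, hK, heK ha⟩] at h
    omega

/-- Without boundary condition 3 N_el > 2 N_el + 4 requires N_el ≥ 5; with one, 3 N_el > 2 N_el is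
enough. -/
theorem nD_gt_n1_of_L1_D1 {T : TriMesh} {Γ : Finset (Finset Pt)}
    (hΓ : (Γ : Set (Finset Pt)) ⊆ T.boundaryEdges) (F : FEChoice T) (h1 : F.V1 = elemL T 1)
    (hD : F.VD = elemD T 1) (hc : Γ.Nonempty ∨ 5 ≤ T.cells.card) : F.nD > F.n1 Γ := by
  have h2 := n1_le_of_L1 hΓ F h1
  have h3 := three_mul_card_le_nD F hD
  have h4 := Finset.card_pos.2 T.cells_nonempty
  rcases hc with hc | hc
  · have := h2.2 hc
    omega
  · omega

/-- Here 6 N_el > 2 N_el + 4 already holds for N_el ≥ 2. -/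
theorem nD_gt_n1_of_L1_D2 {T : TriMesh} {Γ : Finset (Finset Pt)}
    (hΓ : (Γ : Set (Finset Pt)) ⊆ T.boundaryEdges) (F : FEChoice T) (h1 : F.V1 = elemL T 1)
    (hD : F.VD = elemD T 2) (hc : Γ.Nonempty ∨ 2 ≤ T.cells.card) : F.nD > F.n1 Γ := by
  have h2 := n1_le_of_L1 hΓ F h1
  have h3 := six_mul_card_le_nD F hD
  have h4 := Finset.card_pos.2 T.cells_nonempty
  rcases hc with hc | hc
  · have := h2.2 hc
    omega
  · omega

theorem corollary1 (T : TriMesh) (Γ₁ : Finset (Finset Pt))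
    (hΓ₁ : (Γ₁ : Set (Finset Pt)) ⊆ T.boundaryEdges) (F : FEChoice T)
    (hF :
      (F.V1 = elemL T 2 ∧ F.Vd = elemR1 T ∧
        (edgeVertices Γ₁).ncard + Γ₁.card < T.vertices.ncard) ∨
      (F.Vc = elemN11 T ∧ F.VD = elemD T 2 ∧ 2 ≤ T.cells.card) ∨
      (F.V1 = elemL T 1 ∧ F.VD = elemD T 1 ∧ (Γ₁.Nonempty ∨ 5 ≤ T.cells.card)) ∨
      (F.V1 = elemL T 1 ∧ F.VD = elemD T 2 ∧ (Γ₁.Nonempty ∨ 2 ≤ T.cells.card))) :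
    (F.n1 Γ₁ > F.nd ∨ F.nD > F.nc ∨ F.n1 Γ₁ > F.nc + F.nD ∨ F.nD > F.n1 Γ₁) ∧
    ∀ (A : Mat2 → Mat2 →ₗ[ℝ] Mat2) (u : Quad T), u ∈ states T → F.Admissible Γ₁ A u →
      (¬ ∃ α : ℝ, 0 < α ∧ F.InfSup Γ₁ A u α) ∧
      ∀ ℓ : Quad T → ℝ, ¬ ∃! z : Quad T, F.SolvesNewton Γ₁ A u ℓ z := by
  rcases hF with ⟨h1, hd, hc⟩ | ⟨hc, hD, h2⟩ | ⟨h1, hD, hc⟩ | ⟨h1, hD, hc⟩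
  · have h := n1_gt_nd_of_L2_R1 hΓ₁ F h1 hd hc
    exact ⟨Or.inl h, fun A u _ hu => unstable_of_nd_lt_n1 hu h⟩
  · have h := nD_gt_nc_of_N11_D2 F hc hD h2
    exact ⟨Or.inr (Or.inl h), fun A u _ hu => unstable_of_nc_lt_nD hu h⟩
  · have h := nD_gt_n1_of_L1_D1 hΓ₁ F h1 hD hc
    exact ⟨Or.inr (Or.inr (Or.inr h)), fun A u _ hu => unstable_of_n1_lt_nD hu h⟩
  · have h := nD_gt_n1_of_L1_D2 hΓ₁ F h1 hD hc
    exact ⟨Or.inr (Or.inr (Or.inr h)), fun A u _ hu => unstable_of_n1_lt_nD hu h⟩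

end
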